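/- Let $d\ge 2$. Let $\mathcal O_d$ be the Cuntz algebra, the universal unital C*-algebra generated by $s_1,\dots,s_d$ with $s_i^*s_j=\delta_{ij}1$ and $\sum_i s_is_i^*=1$. For a word $I=(i_1,\dots,i_m)$ in $\{1,\dots,d\}$ put $|I|=m$, $s_I=s_{i_1}\cdots s_{i_m}$ ($s_\emptyset=1$) and $\tilde I=(i_m,\dots,i_1)$. Let $\lambda(x)=\sum_i s_ixs_i^*$, and for $z\in S^1$ let $\beta_z$ be the automorphism of $\mathcal O_d$ with $\beta_z(s_i)=zs_i$. Let $\mathcal B=\bigotimes_{j\in\mathbb Z}M_d(\mathbb C)$ be the UHF C*-algebra, and write $Q^{(j)}$ for the matrix $Q$ placed at the site $j$. Let $\omega$ be a state of $\mathcal B$ that is translation-invariant (invariant under the automorphism $Q^{(j)}\mapsto Q^{(j+1)}$), lattice-symmetric (invariant under the automorphism $Q^{(j)}\mapsto Q^{(1-j)}$) and a factor state ($\pi_\omega(\mathcal B)''$ has trivial center, where $\pi_\omega$ is the GNS representation of $\omega$). Let $K_\omega$ be the convex set of all states $\psi$ of $\mathcal O_d$ with $\psi\circ\lambda=\psi$ and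 $$\psi(s_Is_J^*)=\omega\big(e_{i_1j_1}^{(1)}e_{i_2j_2}^{(2)}\cdots e_{i_kj_k}^{(k)}\big)$$ for all $k\ge 0$ and all words $I=(i_1,\dots,i_k)$, $J=(j_1,\dots,j_k)$, where $e_{ij}\in M_d(\mathbb C)$ are the matrix units. **Proposition 3.1.** For every $\psi\in K_\omega$ there is exactly one bounded linear functional $\tilde\psi$ on $\mathcal O_d$ with $$\tilde\psi(s_Is_J^*)=\psi(s_{\tilde I}s_{\tilde J}^*)\qquad\text{for all words } I,J,$$ and $\psi\mapsto\tilde\psi$ is an affine bijection of $K_\omega$ onto itself. The group $H=\{z\in S^1:\psi\beta_z=\psi\}$ is the same for all extremal points $\psi$ of $K_\omega$; it is either $\{z: z^n=1\}$ for some $n\ge 1$, or $S^1$. Furthermore there exist an extremal point $\psi$ of $K_\omega$ and a $\zeta\in S^1$ with $\zeta^2\in H$ such that $$\tilde\psi=\psi\beta_\zeta,$$ where $\zeta\in\{1,e^{\pi i/n}\}$ if $H=\{z:z^n=1\}$, and $\zeta=1$ if $H=S^1$. -/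

import Mathlib

open scoped ComplexOrder BoundedContinuousFunction

noncomputable section

namespace SpinChain

/-! ### Universal C*-algebras of families of operators on a separable Hilbert space -/

/-- The separable infinite dimensional Hilbert space `ℓ²(ℕ)`. -/
abbrev Hil : Type := lp (fun _ : ℕ => ℂ) 2

/-- The bounded operators on `ℓ²(ℕ)`. -/
abbrev BH : Type := Hil →L[ℂ] Hil

/-- The C*-algebra of bounded families of operators indexed by the discrete space `ι`, with the
pointwise operations and the supremum norm. -/
def BddFamily (ι : Type) [TopologicalSpace ι] : Type := ι →ᵇ BH

instance (ι : Type) [TopologicalSpace ι] : CStarAlgebra (BddFamily ι) :=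
  inferInstanceAs (CStarAlgebra (ι →ᵇ BH))

instance : Nontrivial Hil :=
  ⟨lp.single 2 0 (1 : ℂ), 0, fun h => by
    simpa using congrArg (fun f : Hil => (f : ℕ → ℂ) 0) h⟩

section Universal

variable {ι : Type} [TopologicalSpace ι]

/-- A bounded family of operators. -/
def BddFamily.mk [DiscreteTopology ι] (f : ι → BH) (C : ℝ) (h : ∀ i, ‖f i‖ ≤ C) : BddFamily ι :=
  BoundedContinuousFunction.ofNormedAddCommGroupDiscrete f C h

/-- Re-indexing of bounded families of operators along a self-map of the index set. -/
def pullback [DiscreteTopology ι] (e : ι → ι) : BddFamily ι →⋆ₐ[ℂ] BddFamily ι where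
  toFun f := BoundedContinuousFunction.compContinuous f ⟨e, continuous_of_discreteTopology⟩
  map_one' := rfl
  map_mul' _ _ := rfl
  map_zero' := rfl
  map_add' _ _ := rfl
  commutes' _ := rfl
  map_star' _ := rfl

/-- The C*-algebra generated by the bounded families of operators `gen g`. When `ι` is the set of
all realisations on `ℓ²(ℕ)` of some generators and relations, and `gen g` evaluates the generator
`g` in a realisation, this is the completion of the *-algebra given by these generators and
relations in the norm `‖x‖ = sup {‖π x‖ : π a realisation}`. -/
def generated {G : Type} (gen : G → BddFamily ι) : StarSubalgebra ℂ (BddFamily ι) :=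
  (StarAlgebra.adjoin ℂ (Set.range gen)).topologicalClosure

theorem isClosed_generated {G : Type} (gen : G → BddFamily ι) :
    IsClosed (generated gen : Set (BddFamily ι)) :=
  StarSubalgebra.isClosed_topologicalClosure _

theorem gen_mem_generated {G : Type} (gen : G → BddFamily ι) (g : G) : gen g ∈ generated gen :=
  StarSubalgebra.le_topologicalClosure _ (StarAlgebra.subset_adjoin ℂ _ ⟨g, rfl⟩)

theorem pullback_mem_generated [DiscreteTopology ι] {G : Type} (gen : G → BddFamily ι) (e : ι → ι)
    (h : ∀ g, pullback e (gen g) ∈ generated gen) {x : BddFamily ι} (hx : x ∈ generated gen) :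
    pullback e x ∈ generated gen := by
  have hc : Continuous (pullback e) :=
    AddMonoidHomClass.continuous_of_bound (pullback e) 1 fun x => by
      simpa only [one_mul] using NonUnitalStarAlgHom.norm_apply_le (pullback e) x
  have h1 : (StarAlgebra.adjoin ℂ (Set.range gen)).map (pullback e) ≤ generated gen := by
    rw [StarAlgHom.map_adjoin, StarAlgebra.adjoin_le_iff]
    rintro _ ⟨_, ⟨g, rfl⟩, rfl⟩
    exact h g
  exact StarSubalgebra.topologicalClosure_minimal h1 (isClosed_generated gen)
    (StarSubalgebra.map_topologicalClosure_le _ _ hc ⟨x, hx, rfl⟩)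

/-- The *-endomorphism of `generated gen` induced by a map of realisations. -/
def generatedEnd [DiscreteTopology ι] {G : Type} (gen : G → BddFamily ι) (e : ι → ι)
    (h : ∀ g, pullback e (gen g) ∈ generated gen) : generated gen →⋆ₐ[ℂ] generated gen :=
  StarAlgHom.codRestrict ((pullback e).comp (generated gen).subtype) (generated gen)
    fun x => pullback_mem_generated gen e h x.2

end Universal

/-! ### The Cuntz algebra -/

/-- The families of isometries on `ℓ²(ℕ)` that satisfy the Cuntz relations. -/
structure CuntzFamily (d : ℕ) where
  S : Fin d → BH
  orthogonal : ∀ i j, star (S i) * S j = if i = j then 1 else 0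
  complete : ∑ i, S i * star (S i) = 1

instance (d : ℕ) : TopologicalSpace (CuntzFamily d) := ⊥

instance (d : ℕ) : DiscreteTopology (CuntzFamily d) := ⟨rfl⟩

theorem CuntzFamily.norm_le {d : ℕ} (F : CuntzFamily d) (i : Fin d) : ‖F.S i‖ ≤ 1 := by
  have h : ‖F.S i‖ * ‖F.S i‖ = 1 := by
    rw [← CStarRing.norm_star_mul_self, F.orthogonal i i, if_pos rfl, norm_one]
  nlinarith [norm_nonneg (F.S i)]

/-- The generator `s i` in the realisation `F` is `F.S i`. -/
def cuntzGen (d : ℕ) (i : Fin d) : BddFamily (CuntzFamily d) :=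
  BddFamily.mk (fun F => F.S i) 1 fun F => F.norm_le i

/-- The Cuntz algebra `O_d`: the universal unital C*-algebra generated by isometries
`s 1, …, s d` that satisfy the Cuntz relations. (For `d ≥ 2` the norm of a *-polynomial in the
generators is attained, as a supremum, on cyclic representations, and these act on separable
infinite dimensional spaces, so that realisations on `ℓ²(ℕ)` suffice.) -/
def CuntzAlgebra (d : ℕ) : Type := generated (cuntzGen d)

instance (d : ℕ) : CStarAlgebra (CuntzAlgebra d) :=
  haveI := isClosed_generated (cuntzGen d)
  inferInstanceAs (CStarAlgebra (generated (cuntzGen d)))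

/-- The generating isometries of the Cuntz algebra. -/
def s {d : ℕ} (i : Fin d) : CuntzAlgebra d := ⟨cuntzGen d i, gen_mem_generated _ i⟩

/-- The product `s_I = s_{i_1} ⋯ s_{i_m}` for `I = (i_1, …, i_m)`; it is `1` for the empty word. -/
def word {d : ℕ} (I : List (Fin d)) : CuntzAlgebra d := (I.map s).prod

/-- The canonical endomorphism `λ(x) = ∑ i, s i * x * (s i)*`. -/
def canonicalEndo {d : ℕ} (x : CuntzAlgebra d) : CuntzAlgebra d := ∑ i, s i * x * star (s i)

/-- The Cuntz family `(z S_1, …, z S_d)` for a complex number `z` of modulus one. -/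
def CuntzFamily.rotate {d : ℕ} (z : Circle) (F : CuntzFamily d) : CuntzFamily d where
  S i := (z : ℂ) • F.S i
  orthogonal i j := by
    have hz : star (z : ℂ) * (z : ℂ) = 1 := by simp [← Circle.coe_inv_eq_conj]
    rw [star_smul, smul_mul_smul_comm, hz, one_smul, F.orthogonal]
  complete := by
    have hz : (z : ℂ) * star (z : ℂ) = 1 := by simp [← Circle.coe_inv_eq_conj]
    simp only [star_smul, smul_mul_smul_comm, hz, one_smul, F.complete]

/-- The gauge action `β_z` on the Cuntz algebra, with `β_z (s i) = z • s i`. -/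
def gauge (d : ℕ) (z : Circle) : CuntzAlgebra d →⋆ₐ[ℂ] CuntzAlgebra d :=
  generatedEnd (cuntzGen d) (CuntzFamily.rotate z) fun i =>
    (generated (cuntzGen d)).smul_mem (gen_mem_generated (cuntzGen d) i) (z : ℂ)

theorem gauge_s (d : ℕ) (z : Circle) (i : Fin d) : gauge d z (s i) = (z : ℂ) • s i := rfl

/-! ### The UHF algebra of the two-sided spin chain -/

/-- The families `(ρ_j)`, `j ∈ ℤ`, of commuting unital *-representations on `ℓ²(ℕ)` of the algebra
of `d × d` matrices, i.e. the unital *-representations on `ℓ²(ℕ)` of the algebraic tensor product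
of copies of this algebra indexed by `ℤ`. -/
structure ChainRep (d : ℕ) where
  ρ : ℤ → (Matrix (Fin d) (Fin d) ℂ →⋆ₐ[ℂ] BH)
  commute : ∀ j k, j ≠ k → ∀ Q R, Commute (ρ j Q) (ρ k R)

instance (d : ℕ) : TopologicalSpace (ChainRep d) := ⊥

instance (d : ℕ) : DiscreteTopology (ChainRep d) := ⟨rfl⟩

open scoped Matrix.Norms.L2Operator in
theorem ChainRep.exists_norm_le {d : ℕ} (Q : Matrix (Fin d) (Fin d) ℂ) :
    ∃ C : ℝ, ∀ (F : ChainRep d) (j : ℤ), ‖F.ρ j Q‖ ≤ C :=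
  ⟨‖Q‖, fun F j => by
    let _ : CStarAlgebra (Matrix (Fin d) (Fin d) ℂ) := {}
    exact NonUnitalStarAlgHom.norm_apply_le (F.ρ j) Q⟩

/-- The element `Q^{(j)}` in the realisation `F` is `F.ρ j Q`. -/
def chainGen (d : ℕ) (p : ℤ × Matrix (Fin d) (Fin d) ℂ) : BddFamily (ChainRep d) :=
  BddFamily.mk (fun F => F.ρ p.1 p.2)
    (ChainRep.exists_norm_le p.2).choose
    fun F => (ChainRep.exists_norm_le p.2).choose_spec F p.1

/-- The UHF algebra `⨂_{j ∈ ℤ} M_d(ℂ)`: the completion of the infinite algebraic tensor product in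
its (unique) C*-norm. -/
def SpinAlgebra (d : ℕ) : Type := generated (chainGen d)

instance (d : ℕ) : CStarAlgebra (SpinAlgebra d) :=
  haveI := isClosed_generated (chainGen d)
  inferInstanceAs (CStarAlgebra (generated (chainGen d)))

instance (d : ℕ) : PartialOrder (SpinAlgebra d) := CStarAlgebra.spectralOrder _

instance (d : ℕ) : StarOrderedRing (SpinAlgebra d) := CStarAlgebra.spectralOrderedRing _

/-- The element `Q^{(j)}`: the matrix `Q` at the lattice site `j`. -/
def site {d : ℕ} (j : ℤ) (Q : Matrix (Fin d) (Fin d) ℂ) : SpinAlgebra d :=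
  ⟨chainGen d (j, Q), gen_mem_generated (chainGen d) (j, Q)⟩

/-- Relabelling of the lattice sites. -/
def ChainRep.relabel {d : ℕ} (e : ℤ ≃ ℤ) (F : ChainRep d) : ChainRep d where
  ρ j := F.ρ (e j)
  commute j k h := F.commute (e j) (e k) fun h' => h (e.injective h')

/-- The *-endomorphism of the spin chain that maps `Q^{(j)}` to `Q^{(e j)}`. -/
def relabel (d : ℕ) (e : ℤ ≃ ℤ) : SpinAlgebra d →⋆ₐ[ℂ] SpinAlgebra d :=
  generatedEnd (chainGen d) (ChainRep.relabel e) fun p =>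
    gen_mem_generated (chainGen d) (e p.1, p.2)

theorem relabel_site (d : ℕ) (e : ℤ ≃ ℤ) (j : ℤ) (Q : Matrix (Fin d) (Fin d) ℂ) :
    relabel d e (site j Q) = site (e j) Q := rfl

/-- The translation `θ`, with `θ (Q^{(j)}) = Q^{(j+1)}`. -/
def translation (d : ℕ) : SpinAlgebra d →⋆ₐ[ℂ] SpinAlgebra d := relabel d (Equiv.addRight 1)

/-- The reflection around the point `1/2` of the lattice, which maps `Q^{(j)}` to `Q^{(1-j)}`. -/
def reflection (d : ℕ) : SpinAlgebra d →⋆ₐ[ℂ] SpinAlgebra d := relabel d (Equiv.subLeft 1)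

/-- The product `e_{i_1 j_1}^{(1)} ⋯ e_{i_k j_k}^{(k)}` of matrix units `e_{ij} = |e_i⟩⟨e_j|` at the
sites `1, …, k`, for the list `(i_1, j_1), …, (i_k, j_k)`. -/
def matrixUnits {d : ℕ} (L : List (Fin d × Fin d)) : SpinAlgebra d :=
  (L.mapIdx fun (a : ℕ) p => site ((a : ℤ) + 1) (Matrix.single p.1 p.2 (1 : ℂ))).prod

/-! ### States -/

/-- A state is a factor state if the center `π(A)'' ∩ π(A)'` of the von Neumann algebra generated
by its GNS representation `π` is trivial. -/
def IsFactor {A : Type} [CStarAlgebra A] [PartialOrder A] [StarOrderedRing A]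
    (f : A →ₚ[ℂ] ℂ) : Prop :=
  ∀ T ∈ Set.centralizer (Set.centralizer (Set.range f.gnsStarAlgHom)) ∩
      Set.centralizer (Set.range f.gnsStarAlgHom),
    ∃ c : ℂ, T = c • (1 : f.GNS →L[ℂ] f.GNS)

/-- The convex set `K_ω` of all states `ψ` of the Cuntz algebra that are invariant under the
canonical endomorphism and whose restriction to `UHF_d`, the closed linear span of the
`s_I (s_J)*` with `|I| = |J|`, is the restriction of `ω` to the sites `1, 2, …`, where
`s_I (s_J)*` is identified with the product of the matrix units `e_{i_a j_a}^{(a)}`. -/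
def K {d : ℕ} (ω : SpinAlgebra d →ₚ[ℂ] ℂ) : Set (StrongDual ℂ (CuntzAlgebra d)) :=
  {ψ | (∀ x, 0 ≤ ψ (star x * x)) ∧ ψ 1 = 1 ∧ (∀ x, ψ (canonicalEndo x) = ψ x) ∧
    ∀ L : List (Fin d × Fin d),
      ψ (word (L.map Prod.fst) * star (word (L.map Prod.snd))) = ω (matrixUnits L)}

/-- `φ` is the dual `ψ̃` of `ψ`: one has `φ (s_I (s_J)*) = ψ (s_Ĩ (s_J̃)*)` for all words `I`, `J`,
where `Ĩ` is `I` read backwards. -/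
def IsDual {d : ℕ} (ψ φ : StrongDual ℂ (CuntzAlgebra d)) : Prop :=
  ∀ I J : List (Fin d),
    φ (word I * star (word J)) = ψ (word I.reverse * star (word J.reverse))

end SpinChain

end

/-! The dual exists because reversal of words interchanges two rules for the kernel `k(I, J) = ψ(s_I
s_J*)`. The Cuntz relation `∑ s_p s_p* = 1` says that `k` is reproduced when a letter is appended to
both words and summed over; `λ`-invariance says the same of a letter put in front. The reversed
kernel is therefore positive definite and consistent, `IsStateKernel.exists_state` turns it into a
state, and the symmetries of `ω` place this state in `K ω`. The monomials span a dense subspace, so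
the dual is unique; dualising is an affine involution.

The rest depends on clustering of extremal points. Since `λ(x) s_i = s_i x`, the averages `M_N(x)`
of the `λⁿ(x)` are asymptotically central. For self-adjoint `x` the mean ergodic theorem in the GNS
space of `ψ` gives a functional `χ(y) = lim ψ(M_N(x) y)`, which is `λ`-invariant and dominated by
`‖x‖ ψ`. Factoriality of `ω` makes averages of matrix units converge to scalars, whence `χ = ψ(x) ψ`
on `UHF_d`. So `ψ ± t (χ - ψ(x) ψ)` lies in `K ω` for small `t`, and extremality forces `χ = ψ(x)
ψ`. It follows that `ψ(M_N(x) M_N(y))` tends to `ψ(x) ψ(y)`.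

If `x` and `y` have the same gauge degree, then `M_N(x) M_N(y)*` has degree zero, where `ψ` is
determined by `ω`. Hence `ψ(x) conj ψ(y)`, and likewise `ψ(x) ψ(y) conj ψ(z)` when the degrees of
`x` and `y` add up to that of `z`, depend on `ω` only. Two extremal points thus differ in degree `n`
by a phase that is multiplicative on the support subgroup `gℤ`, so that `φ = ψ β_z`
(`IsClusterState.exists_eq_compGauge`), and `H = {z : z^g = 1}`, where `g = 0` means `H = S¹`.

Duality preserves extremality, so the dual of an extremal `ψ` is `ψ β_z` for some `z`. Dualising
twice gives `z² ∈ H`, that is `z^g = ±1`, and `z` may be changed by an element of `H` into `1` or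
`e^{πi/g}`. The argument works for every extremal `ψ`. -/

noncomputable section

namespace SpinChain

open Filter Topology
open scoped InnerProductSpace

/-! ### Ergodic averages in the GNS representation of an invariant state. -/

section Ergodic

variable {A : Type} [CStarAlgebra A]

/-- The ergodic averages of a *-endomorphism. -/
def avg (α : A →⋆ₐ[ℂ] A) (N : ℕ) : A →ₗ[ℂ] A :=
  (N : ℂ)⁻¹ • ∑ n ∈ Finset.range N, α.toAlgHom.toLinearMap ^ n

theorem avg_apply (α : A →⋆ₐ[ℂ] A) (N : ℕ) (x : A) :
    avg α N x = (N : ℂ)⁻¹ • ∑ n ∈ Finset.range N, α^[n] x := by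
  simp [avg, Module.End.pow_apply]

theorem norm_iterate_le (α : A →⋆ₐ[ℂ] A) (n : ℕ) (x : A) : ‖α^[n] x‖ ≤ ‖x‖ := by
  induction n with
  | zero => simp
  | succ n ih =>
    rw [Function.iterate_succ_apply']
    exact (NonUnitalStarAlgHom.norm_apply_le α _).trans ih

theorem norm_avg_le (α : A →⋆ₐ[ℂ] A) (N : ℕ) (x : A) : ‖avg α N x‖ ≤ ‖x‖ := by
  rw [avg_apply, norm_smul]
  rcases Nat.eq_zero_or_pos N with rfl | hN
  · simp
  have h : ‖∑ n ∈ Finset.range N, α^[n] x‖ ≤ N * ‖x‖ := by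
    simpa using norm_sum_le_of_le (Finset.range N) fun n _ => norm_iterate_le α n x
  have hN' : (0 : ℝ) < N := by exact_mod_cast hN
  calc ‖(N : ℂ)⁻¹‖ * ‖∑ n ∈ Finset.range N, α^[n] x‖ ≤ (N : ℝ)⁻¹ * (N * ‖x‖) := by
        rw [norm_inv, Complex.norm_natCast]; gcongr
    _ = ‖x‖ := by field_simp

theorem iterate_star (α : A →⋆ₐ[ℂ] A) (n : ℕ) (x : A) : α^[n] (star x) = star (α^[n] x) := by
  induction n with
  | zero => rfl
  | succ n ih => rw [Function.iterate_succ_apply', Function.iterate_succ_apply', ih, map_star]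

theorem star_avg (α : A →⋆ₐ[ℂ] A) (N : ℕ) (x : A) : star (avg α N x) = avg α N (star x) := by
  simp [avg_apply, star_sum, iterate_star]

/-- The elements that asymptotically commute with each sequence of a *-invariant family. -/
def asympCommutant {ι : Type} (u : ι → ℕ → A) (hu : ∀ i, ∃ j, ∀ n, star (u i n) = u j n) :
    StarSubalgebra ℂ A where
  carrier := {y | ∀ i, Tendsto (fun N => u i N * y - y * u i N) atTop (𝓝 0)}
  algebraMap_mem' c i := by simp [Algebra.algebraMap_eq_smul_one]
  add_mem' {a b} ha hb i := by
    have := (ha i).add (hb i)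
    rw [add_zero] at this
    exact this.congr fun N => by simp only [mul_add, add_mul]; abel
  mul_mem' {a b} ha hb i := by
    have := ((ha i).mul_const b).add ((hb i).const_mul a)
    rw [zero_mul, mul_zero, add_zero] at this
    exact this.congr fun N => by simp only [sub_mul, mul_sub, mul_assoc]; abel
  star_mem' {a} ha i := by
    obtain ⟨j, hj⟩ := hu i
    have := ((ha j).star).neg
    rw [star_zero, neg_zero] at this
    exact this.congr fun N => by simp [← hj]

theorem mem_asympCommutant {ι : Type} (u : ι → ℕ → A)
    (hu : ∀ i, ∃ j, ∀ n, star (u i n) = u j n) (y : A) : y ∈ asympCommutant u hu ↔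
      ∀ i, Tendsto (fun N => u i N * y - y * u i N) atTop (𝓝 0) := Iff.rfl

/-- Uniform boundedness of each sequence makes the asymptotic commutant norm closed, so that it
suffices to test generators. -/
theorem mem_asympCommutant_of_dense {ι : Type} (u : ι → ℕ → A)
    (hu : ∀ i, ∃ j, ∀ n, star (u i n) = u j n) (hb : ∀ i, ∃ C : ℝ, ∀ n, ‖u i n‖ ≤ C)
    (hS : Dense (asympCommutant u hu : Set A)) (y : A) : y ∈ asympCommutant u hu := by
  intro i
  obtain ⟨C, hC⟩ := hb i
  have hC0 : 0 ≤ C := (norm_nonneg _).trans (hC 0)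
  rw [Metric.tendsto_atTop]
  intro ε hε
  obtain ⟨z, hz, hyz⟩ := hS.exists_dist_lt y (ε := ε / (4 * (C + 1))) (by positivity)
  obtain ⟨N₀, hN₀⟩ := Metric.tendsto_atTop.1 (hz i) (ε / 2) (by positivity)
  refine ⟨N₀, fun N hN => ?_⟩
  have h1 := hN₀ N hN
  rw [dist_zero_right] at h1 ⊢
  rw [dist_eq_norm] at hyz
  have e : u i N * y - y * u i N =
    (u i N * z - z * u i N) + (u i N * (y - z) - (y - z) * u i N) := by noncomm_ring
  rw [e]
  have h2 : ‖u i N * (y - z) - (y - z) * u i N‖ ≤ 2 * C * ‖y - z‖ := by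
    calc _ ≤ ‖u i N * (y - z)‖ + ‖(y - z) * u i N‖ := norm_sub_le _ _
      _ ≤ C * ‖y - z‖ + ‖y - z‖ * C := by
        gcongr
        · exact (norm_mul_le _ _).trans (by gcongr; exact hC _)
        · exact (norm_mul_le _ _).trans (by gcongr; exact hC _)
      _ = _ := by ring
  have h3 : 2 * C * ‖y - z‖ ≤ ε / 2 := by
    rw [lt_div_iff₀ (by positivity)] at hyz
    nlinarith [norm_nonneg (y - z)]
  linarith [norm_add_le (u i N * z - z * u i N) (u i N * (y - z) - (y - z) * u i N)]

variable [PartialOrder A]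

theorem map_iterate {f : A →ₚ[ℂ] ℂ} {α : A →⋆ₐ[ℂ] A} (hf : ∀ x, f (α x) = f x) (n : ℕ) (x : A) :
    f (α^[n] x) = f x := by
  induction n with
  | zero => rfl
  | succ n ih => rw [Function.iterate_succ_apply', hf, ih]

theorem map_avg {f : A →ₚ[ℂ] ℂ} {α : A →⋆ₐ[ℂ] A} (hf : ∀ x, f (α x) = f x) {N : ℕ} (hN : N ≠ 0)
    (x : A) : f (avg α N x) = f x := by
  have : (N : ℂ) ≠ 0 := by exact_mod_cast hN
  simp [avg_apply, map_iterate hf, this]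

variable [StarOrderedRing A] (f : A →ₚ[ℂ] ℂ)

/-- The vector of the GNS space that is given by an element of the algebra. -/
def gnsVec : A →ₗ[ℂ] f.GNS where
  toFun a := ((f.toPreGNS a : f.PreGNS) : f.GNS)
  map_add' a b := by rw [map_add, UniformSpace.Completion.coe_add]
  map_smul' c a := by rw [map_smul, UniformSpace.Completion.coe_smul]; rfl

theorem inner_gnsVec (a b : A) : ⟪gnsVec f a, gnsVec f b⟫_ℂ = f (star a * b) :=
  UniformSpace.Completion.inner_coe _ _

theorem norm_gnsVec_sq (a : A) : ((‖gnsVec f a‖ ^ 2 : ℝ) : ℂ) = f (star a * a) := by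
  rw [← inner_gnsVec, inner_self_eq_norm_sq_to_K]; simp

theorem gns_apply_gnsVec (a b : A) : f.gnsStarAlgHom a (gnsVec f b) = gnsVec f (a * b) :=
  PositiveLinearMap.gnsNonUnitalStarAlgHom_apply_coe f

theorem denseRange_gnsVec : DenseRange (gnsVec f) :=
  UniformSpace.Completion.denseRange_coe (α := f.PreGNS)

theorem norm_gns_le (a : A) : ‖f.gnsStarAlgHom a‖ ≤ ‖a‖ :=
  NonUnitalStarAlgHom.norm_apply_le f.gnsStarAlgHom a

theorem norm_gnsVec_mul_le (a b : A) : ‖gnsVec f (a * b)‖ ≤ ‖a‖ * ‖gnsVec f b‖ := by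
  rw [← gns_apply_gnsVec]
  exact (ContinuousLinearMap.le_opNorm _ _).trans (by gcongr; exact norm_gns_le f a)

theorem continuous_gnsVec : Continuous (gnsVec f) :=
  AddMonoidHomClass.continuous_of_bound (gnsVec f) ‖gnsVec f 1‖ fun x => by
    simpa [mul_comm] using norm_gnsVec_mul_le f x 1

theorem eq_of_inner_gnsVec {ξ η : f.GNS} (h : ∀ a, ⟪ξ, gnsVec f a⟫_ℂ = ⟪η, gnsVec f a⟫_ℂ) :
    ξ = η := by
  refine ext_inner_right ℂ fun v => ?_
  have : (fun v => ⟪ξ, v⟫_ℂ) = fun v => ⟪η, v⟫_ℂ :=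
    (denseRange_gnsVec f).equalizer (by fun_prop) (by fun_prop) (funext h)
  exact congrFun this v

theorem map_star_gns (a : A) : f (star a) = star (f a) := map_star f a

/-- The isometry of the GNS space induced by an endomorphism that leaves the state invariant. -/
def koopman {f : A →ₚ[ℂ] ℂ} {α : A →⋆ₐ[ℂ] A} (hf : ∀ x, f (α x) = f x) : f.GNS →L[ℂ] f.GNS :=
  (LinearMap.mkContinuous
    (f.toPreGNS.toLinearMap ∘ₗ α.toAlgHom.toLinearMap ∘ₗ f.ofPreGNS.toLinearMap :
      f.PreGNS →ₗ[ℂ] f.PreGNS) 1 fun x => by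
        rw [one_mul, PositiveLinearMap.preGNS_norm_def, PositiveLinearMap.preGNS_norm_def]
        apply le_of_eq
        congr 2
        change f (star (α (f.ofPreGNS x)) * α (f.ofPreGNS x)) = _
        rw [← map_star, ← map_mul, hf]).completion

theorem koopman_gnsVec {f : A →ₚ[ℂ] ℂ} {α : A →⋆ₐ[ℂ] A} (hf : ∀ x, f (α x) = f x) (a : A) :
    koopman hf (gnsVec f a) = gnsVec f (α a) := by
  simp [koopman, gnsVec]

theorem inner_koopman {f : A →ₚ[ℂ] ℂ} {α : A →⋆ₐ[ℂ] A} (hf : ∀ x, f (α x) = f x) (v w : f.GNS) :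
    ⟪koopman hf v, koopman hf w⟫_ℂ = ⟪v, w⟫_ℂ := by
  induction v, w using UniformSpace.Completion.induction_on₂ with
  | hp => apply isClosed_eq <;> fun_prop
  | ih a b =>
    have h (a b : A) : ⟪koopman hf (gnsVec f a), koopman hf (gnsVec f b)⟫_ℂ =
        ⟪gnsVec f a, gnsVec f b⟫_ℂ := by
      rw [koopman_gnsVec, koopman_gnsVec, inner_gnsVec, inner_gnsVec, ← map_star, ← map_mul, hf]
    exact h (f.ofPreGNS a) (f.ofPreGNS b)

theorem norm_koopman_le {f : A →ₚ[ℂ] ℂ} {α : A →⋆ₐ[ℂ] A} (hf : ∀ x, f (α x) = f x) :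
    ‖koopman hf‖ ≤ 1 := by
  refine ContinuousLinearMap.opNorm_le_bound _ zero_le_one fun v => ?_
  rw [one_mul]
  apply le_of_eq
  rw [← sq_eq_sq₀ (norm_nonneg _) (norm_nonneg _)]
  have := inner_koopman hf v v
  rw [inner_self_eq_norm_sq_to_K, inner_self_eq_norm_sq_to_K] at this
  exact_mod_cast this

theorem birkhoffAverage_koopman {f : A →ₚ[ℂ] ℂ} {α : A →⋆ₐ[ℂ] A} (hf : ∀ x, f (α x) = f x)
    (N : ℕ) (x : A) :
    birkhoffAverage ℂ (koopman hf) id N (gnsVec f x) = gnsVec f (avg α N x) := by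
  have h (n : ℕ) : (koopman hf)^[n] (gnsVec f x) = gnsVec f (α^[n] x) := by
    induction n with
    | zero => rfl
    | succ n ih => rw [Function.iterate_succ_apply', ih, koopman_gnsVec,
        Function.iterate_succ_apply']
  simp [birkhoffAverage, birkhoffSum, avg_apply, h]

/-- The mean ergodic theorem in the GNS representation of an invariant state. -/
theorem exists_tendsto_gnsVec_avg {f : A →ₚ[ℂ] ℂ} {α : A →⋆ₐ[ℂ] A} (hf : ∀ x, f (α x) = f x)
    (x : A) : ∃ η : f.GNS, Tendsto (fun N => gnsVec f (avg α N x)) atTop (𝓝 η) ∧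
      ∀ y, ⟪η, gnsVec f (α y)⟫_ℂ = ⟪η, gnsVec f y⟫_ℂ := by
  have h := (koopman hf).tendsto_birkhoffAverage_orthogonalProjection (norm_koopman_le hf)
    (gnsVec f x)
  simp_rw [birkhoffAverage_koopman] at h
  refine ⟨_, h, fun y => ?_⟩
  set p := ((koopman hf).eqLocus (1 : f.GNS →L[ℂ] f.GNS)).orthogonalProjectionOnto (gnsVec f x)
  have hp : koopman hf p = p := p.2
  rw [← koopman_gnsVec hf]
  -- The limit is fixed by the isometry, so the isometry may be applied on both sides of the inner
  -- product; its adjoint is not needed.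
  nth_rewrite 1 [← hp]
  exact inner_koopman hf _ _

theorem inner_gnsVec_avg {f : A →ₚ[ℂ] ℂ} {α : A →⋆ₐ[ℂ] A} {η : f.GNS}
    (h : ∀ y, ⟪η, gnsVec f (α y)⟫_ℂ = ⟪η, gnsVec f y⟫_ℂ) {N : ℕ} (hN : N ≠ 0) (y : A) :
    ⟪η, gnsVec f (avg α N y)⟫_ℂ = ⟪η, gnsVec f y⟫_ℂ := by
  have h' (n : ℕ) : ⟪η, gnsVec f (α^[n] y)⟫_ℂ = ⟪η, gnsVec f y⟫_ℂ := by
    induction n with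
    | zero => rfl
    | succ n ih => rw [Function.iterate_succ_apply', h, ih]
  have : (N : ℂ) ≠ 0 := by exact_mod_cast hN
  simp [avg_apply, inner_smul_right, inner_sum, h', this]

/-- `f` has the mean clustering property at `x`. -/
def IsClustering (f : A →ₚ[ℂ] ℂ) (α : A →⋆ₐ[ℂ] A) (x : A) : Prop :=
  Tendsto (fun N => gnsVec f (avg α N x)) atTop (𝓝 (gnsVec f (f x • 1)))

/-- The squared distance between the two GNS vectors is `f(M_N(x)* M_N(x)) - |f(x)|²`. Clustering
thus becomes a statement about values of `f`, which can be carried over from `ω` to a state of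
another algebra. -/
theorem isClustering_iff {f : A →ₚ[ℂ] ℂ} {α : A →⋆ₐ[ℂ] A} (hf : ∀ x, f (α x) = f x)
    (h1 : f 1 = 1) (x : A) : IsClustering f α x ↔
      Tendsto (fun N => f (star (avg α N x) * avg α N x)) atTop (𝓝 (star (f x) * f x)) := by
  have key : ∀ᶠ N in atTop, ((‖gnsVec f (avg α N x) - gnsVec f (f x • 1)‖ ^ 2 : ℝ) : ℂ) =
      f (star (avg α N x) * avg α N x) - star (f x) * f x := by
    filter_upwards [eventually_ne_atTop 0] with N hN
    rw [← map_sub, norm_gnsVec_sq]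
    simp only [star_sub, star_smul, star_one, sub_mul, mul_sub, map_sub, mul_smul_comm,
      smul_mul_assoc, mul_one, one_mul, map_smul, smul_eq_mul, h1, map_avg hf hN,
      map_star_gns]
    ring
  rw [IsClustering, tendsto_iff_norm_sub_tendsto_zero]
  constructor
  · intro h
    have h2 : Tendsto (fun N => ((‖gnsVec f (avg α N x) - gnsVec f (f x • 1)‖ ^ 2 : ℝ) : ℂ)) atTop
        (𝓝 ((0 ^ 2 : ℝ) : ℂ)) := (Complex.continuous_ofReal.tendsto _).comp (h.pow 2)
    rw [tendsto_congr' key] at h2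
    simpa using h2.add_const (star (f x) * f x)
  · intro h
    have h2 := h.sub_const (star (f x) * f x)
    rw [← tendsto_congr' key, sub_self] at h2
    have h3 := (Complex.continuous_re.tendsto _).comp h2
    have h4 := h3.sqrt
    simpa only [Function.comp_def, Complex.ofReal_re, Real.sqrt_sq (norm_nonneg _), Complex.zero_re,
      Real.sqrt_zero] using h4

theorem IsClustering.map_mul {f : A →ₚ[ℂ] ℂ} {α : A →⋆ₐ[ℂ] A} (h1 : f 1 = 1)
    (hc : ∀ x, IsClustering f α x) (x y : A) :
    Tendsto (fun N => f (avg α N x * avg α N y)) atTop (𝓝 (f x * f y)) := by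
  have h := (hc (star x)).inner (𝕜 := ℂ) (hc y)
  simp only [inner_gnsVec] at h
  simpa only [star_avg, star_star, star_smul, star_one, smul_mul_smul_comm, mul_one,
    map_star_gns, map_smul, h1, smul_eq_mul] using h

/-- The averages are bounded uniformly in `N`, so the last factor can be replaced by its scalar
limit before the middle one is treated. -/
theorem IsClustering.map_mul_mul {f : A →ₚ[ℂ] ℂ} {α : A →⋆ₐ[ℂ] A} (h1 : f 1 = 1)
    (hc : ∀ x, IsClustering f α x) (x y z : A) :
    Tendsto (fun N => f (avg α N x * avg α N y * avg α N z)) atTop (𝓝 (f x * f y * f z)) := by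
  have h2 : Tendsto (fun N => gnsVec f (avg α N y * avg α N z)) atTop
      (𝓝 (gnsVec f ((f y * f z) • 1))) := by
    have e (N : ℕ) : gnsVec f (avg α N y * avg α N z) = f.gnsStarAlgHom (avg α N y)
        (gnsVec f (avg α N z) - gnsVec f (f z • 1)) + f z • gnsVec f (avg α N y) := by
      rw [← map_sub, gns_apply_gnsVec, mul_sub, map_sub]; simp
    simp_rw [e]
    have h3 : Tendsto (fun N => f.gnsStarAlgHom (avg α N y)
        (gnsVec f (avg α N z) - gnsVec f (f z • 1))) atTop (𝓝 0) := by
      refine squeeze_zero_norm (a := fun N => ‖y‖ * ‖gnsVec f (avg α N z) - gnsVec f (f z • 1)‖)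
        (fun N => ?_) ?_
      · exact (ContinuousLinearMap.le_opNorm _ _).trans
          (by gcongr; exact (norm_gns_le f _).trans (norm_avg_le α N y))
      · simpa using (tendsto_iff_norm_sub_tendsto_zero.1 (hc z)).const_mul ‖y‖
    have h4 := h3.add ((hc y).const_smul (f z))
    rwa [zero_add, ← map_smul, smul_smul, mul_comm] at h4
  have h := (hc (star x)).inner (𝕜 := ℂ) h2
  simp only [inner_gnsVec] at h
  simpa only [star_avg, star_star, star_smul, star_one, smul_mul_smul_comm, mul_one,
    map_star_gns, map_smul, h1, smul_eq_mul, mul_assoc] using h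

end Ergodic

section Generators

variable {ι : Type} [TopologicalSpace ι] {G : Type}

theorem dense_of_gen_mem (gen : G → BddFamily ι) (S : StarSubalgebra ℂ (generated gen))
    (h : ∀ g, (⟨gen g, gen_mem_generated gen g⟩ : generated gen) ∈ S) :
    Dense (S : Set (generated gen)) := by
  intro x
  rw [Topology.IsInducing.subtypeVal.closure_eq_preimage_closure_image]
  have h1 : StarAlgebra.adjoin ℂ (Set.range gen) ≤ S.map (generated gen).subtype := by
    rw [StarAlgebra.adjoin_le_iff]
    rintro _ ⟨g, rfl⟩
    exact ⟨_, h g, rfl⟩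
  have hx : (x : BddFamily ι) ∈ closure (StarAlgebra.adjoin ℂ (Set.range gen) :
      Set (BddFamily ι)) := x.2
  exact closure_mono h1 hx

end Generators

variable {d : ℕ}

/-! ### Evaluation in a realisation -/

/-- The representation of the Cuntz algebra given by a Cuntz family. -/
def CuntzFamily.eval (F : CuntzFamily d) : CuntzAlgebra d →⋆ₐ[ℂ] BH where
  toFun x := (show CuntzFamily d →ᵇ BH from x.1) F
  map_one' := rfl
  map_mul' _ _ := rfl
  map_zero' := rfl
  map_add' _ _ := rfl
  commutes' _ := rfl
  map_star' _ := rfl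

theorem CuntzFamily.eval_s (F : CuntzFamily d) (i : Fin d) : F.eval (s i) = F.S i := rfl

/-- Elements are families indexed by the realisations, so identities can be checked in each
realisation. -/
theorem cuntz_ext {x y : CuntzAlgebra d} (h : ∀ F : CuntzFamily d, F.eval x = F.eval y) : x = y :=
  Subtype.ext (BoundedContinuousFunction.ext h)

/-- The representation of the spin algebra given by commuting representations of the algebra of
matrices. -/
def ChainRep.eval (F : ChainRep d) : SpinAlgebra d →⋆ₐ[ℂ] BH where
  toFun x := (show ChainRep d →ᵇ BH from x.1) F
  map_one' := rfl
  map_mul' _ _ := rfl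
  map_zero' := rfl
  map_add' _ _ := rfl
  commutes' _ := rfl
  map_star' _ := rfl

theorem ChainRep.eval_site (F : ChainRep d) (j : ℤ) (Q : Matrix (Fin d) (Fin d) ℂ) :
    F.eval (site j Q) = F.ρ j Q := rfl

theorem spin_ext {x y : SpinAlgebra d} (h : ∀ F : ChainRep d, F.eval x = F.eval y) : x = y :=
  Subtype.ext (BoundedContinuousFunction.ext h)

theorem cuntz_dense (S : StarSubalgebra ℂ (CuntzAlgebra d)) (h : ∀ i, s i ∈ S) :
    Dense (S : Set (CuntzAlgebra d)) :=
  dense_of_gen_mem (cuntzGen d) S h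

theorem spin_dense (S : StarSubalgebra ℂ (SpinAlgebra d)) (h : ∀ j Q, site j Q ∈ S) :
    Dense (S : Set (SpinAlgebra d)) :=
  dense_of_gen_mem (chainGen d) S fun p => h p.1 p.2

/-! ### Relations in the Cuntz algebra -/

theorem star_s_mul_s (i j : Fin d) :
    star (s i : CuntzAlgebra d) * s j = if i = j then 1 else 0 := by
  refine cuntz_ext fun F => ?_
  rw [map_mul, map_star, F.eval_s, F.eval_s, F.orthogonal]
  split_ifs <;> simp

theorem sum_s_mul_star_s : ∑ i, (s i : CuntzAlgebra d) * star (s i) = 1 := by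
  refine cuntz_ext fun F => ?_
  simp only [map_sum, map_mul, map_star, F.eval_s, F.complete, map_one]

theorem canonicalEndo_mul (x y : CuntzAlgebra d) :
    canonicalEndo (x * y) = canonicalEndo x * canonicalEndo y := by
  simp only [canonicalEndo, Finset.sum_mul_sum]
  refine Finset.sum_congr rfl fun i _ => ?_
  rw [Finset.sum_eq_single i]
  · rw [mul_assoc (s i * x), ← mul_assoc (star (s i)), ← mul_assoc (star (s i)), star_s_mul_s,
      if_pos rfl, one_mul]
    simp only [mul_assoc]
  · intro j _ hj
    rw [mul_assoc (s i * x), ← mul_assoc (star (s i)), ← mul_assoc (star (s i)), star_s_mul_s,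
      if_neg hj.symm]
    simp
  · simp

/-- The canonical endomorphism as a *-homomorphism. -/
def lam (d : ℕ) : CuntzAlgebra d →⋆ₐ[ℂ] CuntzAlgebra d where
  toFun := canonicalEndo
  map_one' := by simp [canonicalEndo, sum_s_mul_star_s]
  map_mul' := canonicalEndo_mul
  map_zero' := by simp [canonicalEndo]
  map_add' x y := by simp [canonicalEndo, mul_add, add_mul, Finset.sum_add_distrib]
  commutes' c := by
    simp [canonicalEndo, Algebra.algebraMap_eq_smul_one, ← Finset.smul_sum, sum_s_mul_star_s]
  map_star' x := by simp [canonicalEndo, star_sum, mul_assoc]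

theorem lam_apply (x : CuntzAlgebra d) : lam d x = canonicalEndo x := rfl

theorem lam_mul_s (x : CuntzAlgebra d) (i : Fin d) : lam d x * s i = s i * x := by
  rw [lam_apply, canonicalEndo, Finset.sum_mul, Finset.sum_eq_single i]
  · rw [mul_assoc, star_s_mul_s, if_pos rfl, mul_one]
  · intro j _ hj
    rw [mul_assoc, star_s_mul_s, if_neg hj, mul_zero]
  · simp

theorem word_nil : word ([] : List (Fin d)) = 1 := rfl

theorem word_cons (i : Fin d) (I : List (Fin d)) : word (i :: I) = s i * word I := by
  simp [word]

theorem word_append (I J : List (Fin d)) : word (I ++ J) = word I * word J := by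
  simp [word]

theorem word_singleton (i : Fin d) : word [i] = s i := by
  simp [word]

/-- The averages of the canonical endomorphism are asymptotically central. -/
theorem tendsto_commutator_avg_lam (x y : CuntzAlgebra d) :
    Tendsto (fun N => avg (lam d) N x * y - y * avg (lam d) N x) atTop (𝓝 0) := by
  refine mem_asympCommutant_of_dense (fun x N => avg (lam d) N x)
    (fun x => ⟨star x, fun N => star_avg _ _ _⟩) (fun x => ⟨‖x‖, fun N => norm_avg_le _ _ _⟩)
    (cuntz_dense _ fun i => ?_) y x
  rw [mem_asympCommutant]
  intro x
  -- Since `s i * λⁿ(x) = λⁿ⁺¹(x) * s i`, the commutator telescopes to two terms divided by `N`.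
  have e (N : ℕ) : avg (lam d) N x * s i - s i * avg (lam d) N x =
      (N : ℂ)⁻¹ • (x * s i - (lam d)^[N] x * s i) := by
    have h1 : ∑ n ∈ Finset.range N, s i * (lam d)^[n] x =
        ∑ n ∈ Finset.range N, (lam d)^[n + 1] x * s i :=
      Finset.sum_congr rfl fun n _ => by rw [Function.iterate_succ_apply', lam_mul_s]
    rw [avg_apply, smul_mul_assoc, mul_smul_comm, Finset.sum_mul, Finset.mul_sum, h1, ← smul_sub,
      ← Finset.sum_sub_distrib, Finset.sum_range_sub']
    rfl
  simp_rw [e]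
  refine squeeze_zero_norm (a := fun N : ℕ => (N : ℝ)⁻¹ * (2 * ‖x‖ * ‖(s i : CuntzAlgebra d)‖))
    (fun N => ?_) ?_
  · rw [norm_smul, norm_inv, Complex.norm_natCast]
    gcongr
    calc _ ≤ ‖x * s i‖ + ‖(lam d)^[N] x * s i‖ := norm_sub_le _ _
      _ ≤ ‖x‖ * ‖(s i : CuntzAlgebra d)‖ + ‖x‖ * ‖(s i : CuntzAlgebra d)‖ := by
        gcongr
        · exact norm_mul_le _ _
        · exact (norm_mul_le _ _).trans (by gcongr; exact norm_iterate_le _ _ _)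
      _ = _ := by ring
  · simpa using tendsto_natCast_atTop_atTop.inv_tendsto_atTop.mul_const
      (2 * ‖x‖ * ‖(s i : CuntzAlgebra d)‖)

/-! ### Matrix units -/

theorem site_mul (j : ℤ) (Q R : Matrix (Fin d) (Fin d) ℂ) : site j (Q * R) = site j Q * site j R :=
  spin_ext fun F => by simp only [map_mul, F.eval_site]

theorem site_star (j : ℤ) (Q : Matrix (Fin d) (Fin d) ℂ) : site j (star Q) = star (site j Q) :=
  spin_ext fun F => by simp only [map_star, F.eval_site]

theorem sum_site_single (j : ℤ) :
    ∑ p : Fin d, site j (Matrix.single p p (1 : ℂ)) = 1 :=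
  spin_ext fun F => by
    simp only [map_sum, F.eval_site, map_one]
    rw [← map_sum, Matrix.sum_single_one, map_one]

theorem site_zero (j : ℤ) : site j (0 : Matrix (Fin d) (Fin d) ℂ) = 0 :=
  spin_ext fun F => by simp only [map_zero, F.eval_site]

theorem site_commute {j k : ℤ} (h : j ≠ k) (Q R : Matrix (Fin d) (Fin d) ℂ) :
    Commute (site j Q) (site k R) :=
  spin_ext fun F => by
    simp only [map_mul, F.eval_site]
    exact F.commute j k h Q R

theorem translation_site (j : ℤ) (Q : Matrix (Fin d) (Fin d) ℂ) :
    translation d (site j Q) = site (j + 1) Q := relabel_site _ _ _ _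

/-- The translation frees site `1` for the first letter. Together with `cuntzUnits_cons` this is the
recursion along which the two systems of matrix units are compared. -/
theorem matrixUnits_cons (p : Fin d × Fin d) (L : List (Fin d × Fin d)) :
    matrixUnits (p :: L) =
      site 1 (Matrix.single p.1 p.2 1) * translation d (matrixUnits L) := by
  rw [matrixUnits, matrixUnits, List.mapIdx_cons, List.prod_cons, map_list_prod]
  congr 1
  simp only [Nat.cast_add, Nat.cast_one]
  congr 1
  refine List.ext_getElem (by simp) fun n h1 h2 => ?_
  simp [translation_site]

theorem matrixUnits_nil : matrixUnits ([] : List (Fin d × Fin d)) = 1 := rfl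

/-- The element `s_I (s_J)*` for the pair of words of the same length that is given by `L`. -/
def cuntzUnits (L : List (Fin d × Fin d)) : CuntzAlgebra d :=
  word (L.map Prod.fst) * star (word (L.map Prod.snd))

theorem cuntzUnits_nil : cuntzUnits ([] : List (Fin d × Fin d)) = 1 := by
  simp [cuntzUnits, word_nil]

theorem cuntzUnits_cons (p : Fin d × Fin d) (L : List (Fin d × Fin d)) :
    cuntzUnits (p :: L) = s p.1 * cuntzUnits L * star (s p.2) := by
  simp [cuntzUnits, word_cons, mul_assoc]

theorem translation_iterate_site (n : ℕ) (j : ℤ) (Q : Matrix (Fin d) (Fin d) ℂ) :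
    (translation d)^[n] (site j Q) = site (j + n) Q := by
  induction n with
  | zero => simp
  | succ n ih =>
    rw [Function.iterate_succ_apply', ih, translation_site]; push_cast; rw [add_assoc]

theorem iterate_mul {A : Type} [CStarAlgebra A] (α : A →⋆ₐ[ℂ] A) (n : ℕ) (x y : A) :
    α^[n] (x * y) = α^[n] x * α^[n] y := by
  induction n with
  | zero => rfl
  | succ n ih => simp only [Function.iterate_succ_apply', ih, map_mul]

theorem iterate_one {A : Type} [CStarAlgebra A] (α : A →⋆ₐ[ℂ] A) (n : ℕ) :
    α^[n] (1 : A) = 1 := by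
  induction n with
  | zero => rfl
  | succ n ih => simp only [Function.iterate_succ_apply', ih, map_one]

/-- After `n` translations the product lives on sites larger than `n`, away from `j ≤ n`. -/
theorem site_commute_translation_iterate (L : List (Fin d × Fin d)) :
    ∀ (n : ℕ) (j : ℤ), j ≤ n → ∀ Q : Matrix (Fin d) (Fin d) ℂ,
      Commute (site j Q) ((translation d)^[n] (matrixUnits L)) := by
  induction L with
  | nil => intro n j _ Q; rw [matrixUnits_nil, iterate_one]; exact Commute.one_right _
  | cons p L ih =>
    intro n j hj Q
    rw [matrixUnits_cons, iterate_mul, translation_iterate_site, ← Function.iterate_succ_apply]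
    exact (site_commute (by omega) _ _).mul_right (ih (n + 1) j (by push_cast; omega) Q)

theorem star_matrixUnits (L : List (Fin d × Fin d)) :
    star (matrixUnits L) = matrixUnits (L.map Prod.swap) := by
  induction L with
  | nil => simp [matrixUnits_nil]
  | cons p L ih =>
    rw [List.map_cons, matrixUnits_cons, matrixUnits_cons, ← ih, star_mul, ← map_star, ← site_star]
    have h := site_commute_translation_iterate (L.map Prod.swap) 1 1 (by simp)
      (Matrix.single p.2 p.1 (1 : ℂ))
    rw [Function.iterate_one, ← ih] at h
    rw [Matrix.star_eq_conjTranspose, Matrix.conjTranspose_single, star_one]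
    exact h.eq.symm

theorem star_cuntzUnits (L : List (Fin d × Fin d)) :
    star (cuntzUnits L) = cuntzUnits (L.map Prod.swap) := by
  simp [cuntzUnits, Function.comp_def]

/-! ### The matrix units of `UHF_d` and of the half chain, side by side. -/

/-- The linear span of the pairs that consist of `s_I (s_J)*` and the corresponding product of
matrix units in the spin algebra. -/
def unitPairs (d : ℕ) : Submodule ℂ (CuntzAlgebra d × SpinAlgebra d) :=
  Submodule.span ℂ (Set.range fun L : List (Fin d × Fin d) => (cuntzUnits L, matrixUnits L))

theorem unit_mem_unitPairs (L : List (Fin d × Fin d)) :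
    (cuntzUnits L, matrixUnits L) ∈ unitPairs d := Submodule.subset_span ⟨L, rfl⟩

/-- The span of pairs serves as the graph of an isomorphism between the two algebras of matrix
units, so that no such map has to be built. Both `λ` and the translation put the pair `(p, p)` in
front and sum over `p`. -/
theorem lam_mem_unitPairs {a : CuntzAlgebra d × SpinAlgebra d} (ha : a ∈ unitPairs d) :
    (lam d a.1, translation d a.2) ∈ unitPairs d := by
  induction ha using Submodule.span_induction with
  | mem x hx =>
    obtain ⟨L, rfl⟩ := hx
    have : (lam d (cuntzUnits L), translation d (matrixUnits L)) =
        ∑ p : Fin d, (cuntzUnits ((p, p) :: L), matrixUnits ((p, p) :: L)) := by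
      refine Prod.ext ?_ ?_
      · rw [Prod.fst_sum]; simp only [cuntzUnits_cons]; rfl
      · rw [Prod.snd_sum]
        simp only [matrixUnits_cons, ← Finset.sum_mul, sum_site_single, one_mul]
    rw [this]
    exact Submodule.sum_mem _ fun p _ => unit_mem_unitPairs _
  | zero =>
    simp only [Prod.fst_zero, Prod.snd_zero, map_zero]
    exact (unitPairs d).zero_mem
  | add x y _ _ hx hy => simpa using add_mem hx hy
  | smul c x _ hx => simpa using Submodule.smul_mem _ c hx

theorem star_mem_unitPairs {a : CuntzAlgebra d × SpinAlgebra d} (ha : a ∈ unitPairs d) :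
    (star a.1, star a.2) ∈ unitPairs d := by
  induction ha using Submodule.span_induction with
  | mem x hx =>
    obtain ⟨L, rfl⟩ := hx
    simp only [star_cuntzUnits, star_matrixUnits]
    exact unit_mem_unitPairs _
  | zero =>
    simp only [Prod.fst_zero, Prod.snd_zero, star_zero]
    exact (unitPairs d).zero_mem
  | add x y _ _ hx hy => simpa using add_mem hx hy
  | smul c x _ hx => simpa using Submodule.smul_mem _ (star c) hx

theorem matrixUnits_append_sum (L : List (Fin d × Fin d)) :
    ∑ p : Fin d, matrixUnits (L ++ [(p, p)]) = matrixUnits L := by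
  induction L with
  | nil => simp [matrixUnits_cons, matrixUnits_nil, sum_site_single]
  | cons q L ih =>
    simp only [List.cons_append, matrixUnits_cons, ← Finset.mul_sum, ← map_sum, ih]

theorem cuntzUnits_append_sum (L : List (Fin d × Fin d)) :
    ∑ p : Fin d, cuntzUnits (L ++ [(p, p)]) = cuntzUnits L := by
  induction L with
  | nil => simp [cuntzUnits_cons, cuntzUnits_nil, sum_s_mul_star_s]
  | cons q L ih =>
    simp only [List.cons_append, cuntzUnits_cons, ← Finset.mul_sum, ← Finset.sum_mul, ih]

/-- Inserting `1 = ∑ e_pp` at the end lengthens a unit, so products need only be computed for units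
of equal length. -/
theorem unit_mem_span_length (m : ℕ) : ∀ L : List (Fin d × Fin d), L.length ≤ m →
    (cuntzUnits L, matrixUnits L) ∈ Submodule.span ℂ
      ((fun L : List (Fin d × Fin d) => (cuntzUnits L, matrixUnits L)) '' {L | L.length = m}) := by
  intro L hL
  obtain ⟨k, rfl⟩ := Nat.exists_eq_add_of_le hL
  clear hL
  induction k generalizing L with
  | zero => exact Submodule.subset_span ⟨L, by simp, rfl⟩
  | succ k ih =>
    have : (cuntzUnits L, matrixUnits L) =
        ∑ p : Fin d, (cuntzUnits (L ++ [(p, p)]), matrixUnits (L ++ [(p, p)])) := by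
      refine Prod.ext ?_ ?_
      · rw [Prod.fst_sum, cuntzUnits_append_sum]
      · rw [Prod.snd_sum, matrixUnits_append_sum]
    rw [this]
    refine Submodule.sum_mem _ fun p _ => ?_
    have := ih (L ++ [(p, p)])
    rwa [List.length_append, List.length_singleton, add_assoc, add_comm 1 k] at this

theorem matrixUnits_cons_mul_cons (p q : Fin d × Fin d) (L L' : List (Fin d × Fin d)) :
    matrixUnits (p :: L) * matrixUnits (q :: L') =
      if p.2 = q.1 then site 1 (Matrix.single p.1 q.2 1) *
        translation d (matrixUnits L * matrixUnits L') else 0 := by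
  have hc := site_commute_translation_iterate L 1 1 (by simp) (Matrix.single q.1 q.2 (1 : ℂ))
  rw [Function.iterate_one] at hc
  have : matrixUnits (p :: L) * matrixUnits (q :: L') =
      site 1 (Matrix.single p.1 p.2 1 * Matrix.single q.1 q.2 1) *
        translation d (matrixUnits L * matrixUnits L') := by
    rw [matrixUnits_cons, matrixUnits_cons, site_mul, map_mul, mul_assoc, mul_assoc,
      ← mul_assoc (translation d _) (site 1 _), ← hc.eq, mul_assoc]
  rw [this]
  split_ifs with h'
  · rw [← h', Matrix.single_mul_single_same, one_mul]
  · rw [Matrix.single_mul_single_of_ne (h := h'), site_zero, zero_mul]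

theorem matrixUnits_zip_mul_zip : ∀ A B C : List (Fin d), A.length = B.length →
    B.length = C.length →
    matrixUnits (A.zip B) * matrixUnits (B.zip C) = matrixUnits (A.zip C)
  | [], [], [], _, _ => by simp [matrixUnits_nil]
  | a :: A, b :: B, c :: C, h1, h2 => by
    simp only [List.zip_cons_cons]
    rw [matrixUnits_cons_mul_cons, if_pos rfl,
      matrixUnits_zip_mul_zip A B C (by simpa using h1) (by simpa using h2), matrixUnits_cons]

theorem unit_mul_unit_mem (L : List (Fin d × Fin d)) : ∀ L' : List (Fin d × Fin d),
    L.length = L'.length →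
    (cuntzUnits L * cuntzUnits L' = 0 ∧ matrixUnits L * matrixUnits L' = 0) ∨
    ∃ M, cuntzUnits L * cuntzUnits L' = cuntzUnits M ∧
      matrixUnits L * matrixUnits L' = matrixUnits M := by
  induction L with
  | nil =>
    intro L' h
    rw [List.length_nil, eq_comm, List.length_eq_zero_iff] at h
    subst h
    exact Or.inr ⟨[], by simp [cuntzUnits_nil], by simp [matrixUnits_nil]⟩
  | cons p L ih =>
    intro L' h
    cases L' with
    | nil => simp at h
    | cons q L' =>
      have hE : cuntzUnits (p :: L) * cuntzUnits (q :: L') =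
          if p.2 = q.1 then s p.1 * (cuntzUnits L * cuntzUnits L') * star (s q.2) else 0 := by
        have : cuntzUnits (p :: L) * cuntzUnits (q :: L') =
          s p.1 * cuntzUnits L * (star (s p.2) * s q.1) * cuntzUnits L' * star (s q.2) := by
          simp only [cuntzUnits_cons, mul_assoc]
        rw [this, star_s_mul_s]
        split_ifs <;> simp [mul_assoc]
      rw [hE, matrixUnits_cons_mul_cons]
      by_cases h' : p.2 = q.1
      · simp only [if_pos h']
        rcases ih L' (by simpa using h) with ⟨h1, h2⟩ | ⟨M, h1, h2⟩
        · exact Or.inl (by simp [h1, h2])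
        · exact Or.inr ⟨(p.1, q.2) :: M, by simp [h1, cuntzUnits_cons],
            by simp [h2, matrixUnits_cons]⟩
      · exact Or.inl (by simp [if_neg h'])

theorem mul_mem_unitPairs {a b : CuntzAlgebra d × SpinAlgebra d} (ha : a ∈ unitPairs d)
    (hb : b ∈ unitPairs d) : a * b ∈ unitPairs d := by
  induction ha, hb using Submodule.span_induction₂ with
  | mem_mem x y hx hy =>
    obtain ⟨L, rfl⟩ := hx
    obtain ⟨L', rfl⟩ := hy
    have h1 := unit_mem_span_length (max L.length L'.length) L (le_max_left _ _)
    have h2 := unit_mem_span_length (max L.length L'.length) L' (le_max_right _ _)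
    change (cuntzUnits L, matrixUnits L) * (cuntzUnits L', matrixUnits L') ∈ unitPairs d
    -- Only membership in the span of units of the common length is kept, so that a second induction
    -- can run over that span.
    generalize (cuntzUnits L, matrixUnits L) = x at h1 ⊢
    generalize (cuntzUnits L', matrixUnits L') = y at h2 ⊢
    induction h1, h2 using Submodule.span_induction₂ with
    | mem_mem x y hx hy =>
      obtain ⟨M, hM, rfl⟩ := hx
      obtain ⟨M', hM', rfl⟩ := hy
      rcases unit_mul_unit_mem M M' (hM.trans hM'.symm) with ⟨h1, h2⟩ | ⟨R, h1, h2⟩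
      · rw [Prod.mk_mul_mk, h1, h2]; exact (unitPairs d).zero_mem
      · simp only [Prod.mk_mul_mk, h1, h2]
        exact unit_mem_unitPairs R
    | zero_left => simp
    | zero_right => simp
    | add_left x y z _ _ _ h1 h2 => rw [add_mul]; exact add_mem h1 h2
    | add_right x y z _ _ _ h1 h2 => rw [mul_add]; exact add_mem h1 h2
    | smul_left c x y _ _ h => rw [smul_mul_assoc]; exact Submodule.smul_mem _ c h
    | smul_right c x y _ _ h => rw [mul_smul_comm]; exact Submodule.smul_mem _ c h
  | zero_left => simp
  | zero_right => simp
  | add_left x y z _ _ _ h1 h2 => rw [add_mul]; exact add_mem h1 h2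
  | add_right x y z _ _ _ h1 h2 => rw [mul_add]; exact add_mem h1 h2
  | smul_left c x y _ _ h => rw [smul_mul_assoc]; exact Submodule.smul_mem _ c h
  | smul_right c x y _ _ h => rw [mul_smul_comm]; exact Submodule.smul_mem _ c h

theorem avg_mem_unitPairs {a : CuntzAlgebra d × SpinAlgebra d} (ha : a ∈ unitPairs d) (N : ℕ) :
    (avg (lam d) N a.1, avg (translation d) N a.2) ∈ unitPairs d := by
  have h (n : ℕ) : ((lam d)^[n] a.1, (translation d)^[n] a.2) ∈ unitPairs d := by
    induction n with
    | zero => simpa only [Function.iterate_zero, id_eq] using ha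
    | succ n ih =>
      simpa only [Function.iterate_succ_apply'] using lam_mem_unitPairs ih
  have : (avg (lam d) N a.1, avg (translation d) N a.2) =
      (N : ℂ)⁻¹ • ∑ n ∈ Finset.range N, ((lam d)^[n] a.1, (translation d)^[n] a.2) := by
    simp [avg_apply, Prod.ext_iff, Prod.fst_sum, Prod.snd_sum]
  rw [this]
  exact Submodule.smul_mem _ _ (Submodule.sum_mem _ fun n _ => h n)

theorem mem_K_iff {ω : SpinAlgebra d →ₚ[ℂ] ℂ} {ψ : StrongDual ℂ (CuntzAlgebra d)} :
    ψ ∈ K ω ↔ (∀ x, 0 ≤ ψ (star x * x)) ∧ ψ 1 = 1 ∧ (∀ x, ψ (lam d x) = ψ x) ∧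
      ∀ L : List (Fin d × Fin d), ψ (cuntzUnits L) = ω (matrixUnits L) := by
  unfold K
  rw [Set.mem_ofPred_eq]
  rfl

theorem K_apply_units {ω : SpinAlgebra d →ₚ[ℂ] ℂ} {ψ : StrongDual ℂ (CuntzAlgebra d)}
    (hψ : ψ ∈ K ω) (L : List (Fin d × Fin d)) : ψ (cuntzUnits L) = ω (matrixUnits L) := by
  rw [mem_K_iff] at hψ
  exact hψ.2.2.2 L

/-- This lets the values of `ψ` on products of averages of matrix units be computed in the spin
chain. -/
theorem eq_of_mem_unitPairs {ω : SpinAlgebra d →ₚ[ℂ] ℂ} {ψ : StrongDual ℂ (CuntzAlgebra d)}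
    (hψ : ψ ∈ K ω) {a : CuntzAlgebra d × SpinAlgebra d} (ha : a ∈ unitPairs d) :
    ψ a.1 = ω a.2 := by
  have h : Set.EqOn (ψ.toLinearMap ∘ₗ LinearMap.fst ℂ (CuntzAlgebra d) (SpinAlgebra d))
      (ω.toLinearMap ∘ₗ LinearMap.snd ℂ (CuntzAlgebra d) (SpinAlgebra d))
      (Set.range fun L : List (Fin d × Fin d) => (cuntzUnits L, matrixUnits L)) := by
    rintro _ ⟨L, rfl⟩
    exact K_apply_units hψ L
  exact LinearMap.eqOn_span h ha

/-! ### Mean clustering of the factor state and of the extremal points. -/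

/-- Strong convergence of a bounded sequence of operators follows from its convergence on a dense
set of vectors. -/
theorem exists_strong_limit_of_dense {E F : Type*} [NormedAddCommGroup E] [NormedSpace ℂ E]
    [CompleteSpace E] [NormedAddCommGroup F] [NormedSpace ℂ F] [CompleteSpace F]
    (x : ℕ → E →L[ℂ] F) {C : ℝ} (hC : ∀ n, ‖x n‖ ≤ C) {D : Set E}
    (hD : Dense D) (h : ∀ v ∈ D, ∃ w, Tendsto (fun n => x n v) atTop (𝓝 w)) :
    ∃ T : E →L[ℂ] F, ∀ v, Tendsto (fun n => x n v) atTop (𝓝 (T v)) := by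
  have hC0 : 0 ≤ C := (norm_nonneg _).trans (hC 0)
  have key : ∀ v, ∃ w, Tendsto (fun n => x n v) atTop (𝓝 w) := by
    intro v
    apply cauchySeq_tendsto_of_complete
    rw [Metric.cauchySeq_iff]
    intro ε hε
    obtain ⟨z, hz, hvz⟩ := hD.exists_dist_lt v (ε := ε / (4 * (C + 1))) (by positivity)
    obtain ⟨w, hw⟩ := h z hz
    obtain ⟨N₀, hN₀⟩ := Metric.cauchySeq_iff.1 hw.cauchySeq (ε / 2) (by positivity)
    refine ⟨N₀, fun m hm n hn => ?_⟩
    have h1 := hN₀ m hm n hn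
    have h2 (n : ℕ) : dist (x n v) (x n z) ≤ C * dist v z := by
      rw [dist_eq_norm, ← map_sub, dist_eq_norm]
      exact (ContinuousLinearMap.le_opNorm _ _).trans (by gcongr; exact hC n)
    have h3 : C * dist v z ≤ ε / 4 := by
      rw [lt_div_iff₀ (by positivity)] at hvz
      nlinarith [dist_nonneg (x := v) (y := z)]
    have h4 := dist_triangle4 (x m v) (x m z) (x n z) (x n v)
    have h5 := h2 n
    rw [dist_comm] at h5
    linarith [h2 m]
  choose T hT using key
  exact ⟨continuousLinearMapOfTendsto x (tendsto_pi_nhds.2 hT), hT⟩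

theorem tendsto_commutator_translation (L : List (Fin d × Fin d)) (b : SpinAlgebra d) :
    Tendsto (fun n => (translation d)^[n] (matrixUnits L) * b -
      b * (translation d)^[n] (matrixUnits L)) atTop (𝓝 0) := by
  refine mem_asympCommutant_of_dense (fun L n => (translation d)^[n] (matrixUnits L))
    (fun L => ⟨L.map Prod.swap, fun n => by rw [← star_matrixUnits, iterate_star]⟩)
    (fun L => ⟨‖matrixUnits L‖, fun n => norm_iterate_le _ _ _⟩)
    (spin_dense _ fun j Q => ?_) b L
  rw [mem_asympCommutant]
  intro L
  refine tendsto_const_nhds.congr' ?_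
  -- Once the units have been shifted past the site `j`, the commutator vanishes exactly.
  filter_upwards [eventually_ge_atTop j.toNat] with n hn
  rw [(site_commute_translation_iterate L n j (by omega) Q).eq, sub_self]

theorem tendsto_commutator_avg_translation (L : List (Fin d × Fin d)) (b : SpinAlgebra d) :
    Tendsto (fun N => avg (translation d) N (matrixUnits L) * b -
      b * avg (translation d) N (matrixUnits L)) atTop (𝓝 0) := by
  refine (tendsto_commutator_translation L b).cesaro_smul.congr fun N => ?_
  rw [avg_apply, smul_mul_assoc, mul_smul_comm, Finset.sum_mul, Finset.mul_sum, ← smul_sub,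
    ← Finset.sum_sub_distrib, ← Complex.coe_smul]
  simp

/-- A translation invariant factor state has the mean clustering property. -/
theorem isClustering_matrixUnits {ω : SpinAlgebra d →ₚ[ℂ] ℂ} (h1 : ω 1 = 1)
    (hinv : ∀ x, ω (translation d x) = ω x) (hfactor : IsFactor ω) (L : List (Fin d × Fin d)) :
    IsClustering ω (translation d) (matrixUnits L) := by
  obtain ⟨η, hη, hη'⟩ := exists_tendsto_gnsVec_avg hinv (matrixUnits L)
  let x (N : ℕ) := ω.gnsStarAlgHom (avg (translation d) N (matrixUnits L))
  have hcomm (b : SpinAlgebra d) : Tendsto (fun N => x N * ω.gnsStarAlgHom b -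
      ω.gnsStarAlgHom b * x N) atTop (𝓝 0) := by
    refine squeeze_zero_norm (fun N => ?_)
      (tendsto_zero_iff_norm_tendsto_zero.1 (tendsto_commutator_avg_translation L b))
    rw [← map_mul, ← map_mul, ← map_sub]
    exact norm_gns_le _ _
  have hcomm' (b : SpinAlgebra d) (v : ω.GNS) : Tendsto (fun N => x N (ω.gnsStarAlgHom b v) -
      ω.gnsStarAlgHom b (x N v)) atTop (𝓝 0) := by
    have := ((ContinuousLinearMap.apply ℂ ω.GNS v).continuous.tendsto 0).comp (hcomm b)
    rw [map_zero] at this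
    exact this
  -- On a vector `π(b)Ω` the averages converge to `π(b)η`, because they asymptotically commute with
  -- `π(b)`.
  obtain ⟨T, hT⟩ := exists_strong_limit_of_dense x
    (fun N => (norm_gns_le _ _).trans (norm_avg_le _ _ _)) (denseRange_gnsVec ω) (by
      rintro _ ⟨b, rfl⟩
      refine ⟨ω.gnsStarAlgHom b η, ?_⟩
      have h2 : Tendsto (fun N => ω.gnsStarAlgHom b (x N (gnsVec ω 1))) atTop
          (𝓝 (ω.gnsStarAlgHom b η)) := by
        refine ((ω.gnsStarAlgHom b).continuous.tendsto η).comp (hη.congr fun N => ?_)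
        simp only [x, gns_apply_gnsVec, mul_one]
      have h3 := (hcomm' b (gnsVec ω 1)).add h2
      simpa only [sub_add_cancel, gns_apply_gnsVec ω b 1, mul_one, zero_add] using h3)
  -- As a strong limit of elements of `π(A)`, the operator `T` lies in the bicommutant; asymptotic
  -- commutation puts it in the commutant as well.
  obtain ⟨c, hc⟩ := hfactor T ⟨by
    rw [Set.mem_centralizer_iff]
    intro S hS
    rw [Set.mem_centralizer_iff] at hS
    ext v
    have h2 := (S.continuous.tendsto (T v)).comp (hT v)
    refine tendsto_nhds_unique h2 ((hT (S v)).congr fun N => ?_)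
    have := hS (x N) ⟨_, rfl⟩
    exact DFunLike.congr_fun this v, by
    rw [Set.mem_centralizer_iff]
    rintro _ ⟨b, rfl⟩
    ext v
    have h2 := ((ω.gnsStarAlgHom b).continuous.tendsto (T v)).comp (hT v)
    have h3 := (hcomm' b v).add h2
    simp only [Function.comp_apply, sub_add_cancel, zero_add] at h3
    exact tendsto_nhds_unique h3 (hT _)⟩
  have hlim : Tendsto (fun N => gnsVec ω (avg (translation d) N (matrixUnits L))) atTop
      (𝓝 (gnsVec ω (c • 1))) := by
    have := hT (gnsVec ω 1)
    rw [hc] at this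
    simp only [x, gns_apply_gnsVec, mul_one] at this
    rw [map_smul]
    exact this
  have hcω : c = ω (matrixUnits L) := by
    have h2 := (tendsto_const_nhds (x := gnsVec ω (1 : SpinAlgebra d))).inner (𝕜 := ℂ) hlim
    simp only [inner_gnsVec, star_one, one_mul, map_smul ω, h1, smul_eq_mul, mul_one] at h2
    refine tendsto_nhds_unique h2 (tendsto_const_nhds.congr' ?_)
    filter_upwards [eventually_ne_atTop 0] with N hN
    rw [map_avg hinv hN]
  rw [hcω] at hlim
  exact hlim

instance (d : ℕ) : PartialOrder (CuntzAlgebra d) := CStarAlgebra.spectralOrder _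

instance (d : ℕ) : StarOrderedRing (CuntzAlgebra d) := CStarAlgebra.spectralOrderedRing _

/-- A continuous functional with `0 ≤ ψ (x* x)` as a positive linear map. -/
def toPositive (ψ : StrongDual ℂ (CuntzAlgebra d)) (h : ∀ x, 0 ≤ ψ (star x * x)) :
    CuntzAlgebra d →ₚ[ℂ] ℂ :=
  PositiveLinearMap.mk₀ ψ.toLinearMap fun x hx => by
    obtain ⟨y, rfl⟩ := CStarAlgebra.nonneg_iff_eq_star_mul_self.1 hx
    exact h y

theorem toPositive_apply (ψ : StrongDual ℂ (CuntzAlgebra d)) (h : ∀ x, 0 ≤ ψ (star x * x))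
    (x : CuntzAlgebra d) : toPositive ψ h x = ψ x := rfl

theorem map_star_of_nonneg {ψ : StrongDual ℂ (CuntzAlgebra d)} (h : ∀ x, 0 ≤ ψ (star x * x))
    (x : CuntzAlgebra d) : ψ (star x) = star (ψ x) :=
  map_star_gns (toPositive ψ h) x

/-- The criterion `isClustering_iff` involves only values on `unitPairs`, where `ψ` and `ω` agree.
Extremality plays no role yet. -/
theorem isClustering_cuntzUnits {ω : SpinAlgebra d →ₚ[ℂ] ℂ} (h1 : ω 1 = 1)
    (hinv : ∀ x, ω (translation d x) = ω x) (hfactor : IsFactor ω)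
    {ψ : StrongDual ℂ (CuntzAlgebra d)} (hψ : ψ ∈ K ω) (h : ∀ x, 0 ≤ ψ (star x * x))
    (L : List (Fin d × Fin d)) :
    IsClustering (toPositive ψ h) (lam d) (cuntzUnits L) := by
  have hK := mem_K_iff.1 hψ
  rw [isClustering_iff (fun x => hK.2.2.1 x) hK.2.1]
  have hω := (isClustering_iff hinv h1 _).1 (isClustering_matrixUnits h1 hinv hfactor L)
  simp only [toPositive_apply]
  rw [K_apply_units hψ]
  refine hω.congr fun N => ?_
  have hm := avg_mem_unitPairs (unit_mem_unitPairs L) N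
  exact (eq_of_mem_unitPairs hψ (mul_mem_unitPairs (star_mem_unitPairs hm) hm)).symm

theorem IsClustering.add {A : Type} [CStarAlgebra A] [PartialOrder A] [StarOrderedRing A]
    {f : A →ₚ[ℂ] ℂ} {α : A →⋆ₐ[ℂ] A} {x y : A} (hx : IsClustering f α x)
    (hy : IsClustering f α y) : IsClustering f α (x + y) := by
  have h := Tendsto.add hx hy
  rw [IsClustering]
  simpa only [map_add, add_smul] using h

theorem IsClustering.smul {A : Type} [CStarAlgebra A] [PartialOrder A] [StarOrderedRing A]
    {f : A →ₚ[ℂ] ℂ} {α : A →⋆ₐ[ℂ] A} {x : A} (hx : IsClustering f α x) (c : ℂ) :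
    IsClustering f α (c • x) := by
  have h := Tendsto.const_smul hx c
  rw [IsClustering]
  simpa only [map_smul, smul_assoc] using h

/-- The functional `y ↦ lim ψ (M_N(x)* y)` for the averages `M_N(x)` of `x`. -/
theorem exists_limit_functional {ω : SpinAlgebra d →ₚ[ℂ] ℂ} (h1 : ω 1 = 1)
    (hinv : ∀ x, ω (translation d x) = ω x) (hfactor : IsFactor ω)
    {ψ : StrongDual ℂ (CuntzAlgebra d)} (hψ : ψ ∈ K ω) (h : ∀ x, 0 ≤ ψ (star x * x))
    {x : CuntzAlgebra d} (hx : IsSelfAdjoint x) :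
    ∃ (η : (toPositive ψ h).GNS) (χ : StrongDual ℂ (CuntzAlgebra d)),
      Tendsto (fun N => gnsVec (toPositive ψ h) (avg (lam d) N x)) atTop (𝓝 η) ∧
      (∀ y, χ y = ⟪η, gnsVec (toPositive ψ h) y⟫_ℂ) ∧
      (∀ y, χ (lam d y) = χ y) ∧
      (∀ L, χ (cuntzUnits L) = ψ x * ψ (cuntzUnits L)) ∧
      (∀ y, 0 ≤ ‖x‖ * ψ (star y * y) + χ (star y * y) ∧
        0 ≤ ‖x‖ * ψ (star y * y) - χ (star y * y)) := by
  have hK := mem_K_iff.1 hψ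
  have hfinv : ∀ x, toPositive ψ h (lam d x) = toPositive ψ h x := fun x => hK.2.2.1 x
  obtain ⟨η, hη, hη'⟩ := exists_tendsto_gnsVec_avg hfinv x
  let χ : StrongDual ℂ (CuntzAlgebra d) :=
    (innerSL ℂ η).comp ⟨gnsVec (toPositive ψ h), continuous_gnsVec _⟩
  have hχ (y : CuntzAlgebra d) : χ y = ⟪η, gnsVec (toPositive ψ h) y⟫_ℂ := rfl
  have hsa (N : ℕ) : star (avg (lam d) N x) = avg (lam d) N x := by
    rw [star_avg, hx.star_eq]
  have hlim (y : CuntzAlgebra d) : Tendsto (fun N => ψ (avg (lam d) N x * y)) atTop (𝓝 (χ y)) := by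
    have h2 := hη.inner (𝕜 := ℂ) (tendsto_const_nhds (x := gnsVec (toPositive ψ h) y))
    simp only [inner_gnsVec, hsa] at h2
    exact h2
  have hχ1 : χ 1 = ψ x := by
    refine tendsto_nhds_unique (hlim 1) (tendsto_const_nhds.congr' ?_)
    filter_upwards [eventually_ne_atTop 0] with N hN
    rw [mul_one]
    exact (map_avg hfinv hN x).symm
  refine ⟨η, χ, hη, hχ, fun y => hη' y, fun L => ?_, fun y => ?_⟩
  -- Pairing with the invariant vector `η` does not distinguish the unit from its averages, whose
  -- vectors tend to a multiple of the cyclic vector.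
  · have hc := isClustering_cuntzUnits h1 hinv hfactor hψ h L
    have h2 := (tendsto_const_nhds (x := η)).inner (𝕜 := ℂ) hc
    rw [map_smul, inner_smul_right, ← hχ, hχ1, toPositive_apply, mul_comm] at h2
    refine tendsto_nhds_unique (tendsto_const_nhds.congr' ?_) h2
    filter_upwards [eventually_ne_atTop 0] with N hN
    rw [inner_gnsVec_avg hη' hN, hχ]
  -- Asymptotic centrality allows the average to stand between `y*` and `y`, where `-‖x‖ ≤ M_N(x) ≤
  -- ‖x‖` yields both bounds.
  · have hlim2 : Tendsto (fun N => ψ (star y * avg (lam d) N x * y)) atTop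
        (𝓝 (χ (star y * y))) := by
      have h2 := (tendsto_commutator_avg_lam x (star y)).mul_const y
      have h3 := (ψ.continuous.tendsto _).comp h2
      have h4 := (hlim (star y * y)).sub h3
      rw [zero_mul, map_zero, sub_zero] at h4
      refine h4.congr fun N => ?_
      simp only [Function.comp_apply, ← map_sub]
      congr 1
      noncomm_ring
    have hle (N : ℕ) : avg (lam d) N x ≤ algebraMap ℝ (CuntzAlgebra d) ‖x‖ :=
      (IsSelfAdjoint.le_algebraMap_norm_self (hsa N)).trans
        (algebraMap_mono _ (norm_avg_le _ _ _))
    have hge (N : ℕ) : -avg (lam d) N x ≤ algebraMap ℝ (CuntzAlgebra d) ‖x‖ := by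
      have : IsSelfAdjoint (-avg (lam d) N x) := IsSelfAdjoint.neg (hsa N)
      refine this.le_algebraMap_norm_self.trans (algebraMap_mono _ ?_)
      rw [norm_neg]; exact norm_avg_le _ _ _
    have hconj : star y * algebraMap ℝ (CuntzAlgebra d) ‖x‖ * y = (‖x‖ : ℂ) • (star y * y) := by
      rw [Algebra.algebraMap_eq_smul_one, mul_smul_comm, smul_mul_assoc, mul_one, Complex.coe_smul]
    constructor
    · refine ge_of_tendsto' (hlim2.const_add _) fun N => ?_
      have := (toPositive ψ h).map_nonneg
        (sub_nonneg.2 (star_left_conjugate_le_conjugate (hge N) y))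
      rw [hconj, map_sub, map_smul, smul_eq_mul, mul_neg, neg_mul, map_neg, sub_neg_eq_add] at this
      exact this
    · refine ge_of_tendsto' (hlim2.const_sub _) fun N => ?_
      have := (toPositive ψ h).map_nonneg
        (sub_nonneg.2 (star_left_conjugate_le_conjugate (hle N) y))
      rw [hconj, map_sub, map_smul, smul_eq_mul] at this
      exact this

/-- For small `t` the functionals `ψ ± t (χ - ψ(x) ψ)` remain in `K ω` and have midpoint `ψ`.
Extremality gives `χ = ψ(x) ψ`, which identifies the limit vector `η`. -/
theorem isClustering_of_isSelfAdjoint {ω : SpinAlgebra d →ₚ[ℂ] ℂ} (h1 : ω 1 = 1)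
    (hinv : ∀ x, ω (translation d x) = ω x) (hfactor : IsFactor ω)
    {ψ : StrongDual ℂ (CuntzAlgebra d)} (hψ : ψ ∈ (K ω).extremePoints ℝ)
    (h : ∀ x, 0 ≤ ψ (star x * x)) {x : CuntzAlgebra d} (hx : IsSelfAdjoint x) :
    IsClustering (toPositive ψ h) (lam d) x := by
  have hK := mem_K_iff.1 hψ.1
  obtain ⟨η, χ, hη, hχ, hχlam, hχunits, hχpos⟩ :=
    exists_limit_functional h1 hinv hfactor hψ.1 h hx
  have hψx : star (ψ x) = ψ x := by rw [← map_star_of_nonneg h, hx.star_eq]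
  have hχ1 : χ 1 = ψ x := by
    have := hχunits []
    rwa [cuntzUnits_nil, hK.2.1, mul_one] at this
  have hmem (u : ℝ) (hu : |u| * (2 * ‖x‖) ≤ 1) : ψ + (u : ℂ) • (χ - ψ x • ψ) ∈ K ω := by
    rw [mem_K_iff]
    refine ⟨fun y => ?_, ?_, fun y => ?_, fun L => ?_⟩
    · have hp := hχpos y
      have hp1 := hχpos 1
      simp only [star_one, hK.2.1, mul_one, hχ1] at hp1
      have hy := h y
      simp only [add_apply, smul_apply, sub_apply, smul_eq_mul]
      rw [Complex.nonneg_iff] at hp hp1 hy ⊢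
      rw [Complex.nonneg_iff] at hp hp1
      simp only [Complex.add_re, Complex.sub_re, Complex.mul_re, Complex.ofReal_re,
        Complex.ofReal_im, Complex.add_im, Complex.sub_im, Complex.mul_im, ← hy.2] at hp hp1 ⊢
      obtain ⟨⟨a1, a2⟩, a3, a4⟩ := hp
      obtain ⟨⟨b1, b2⟩, b3, b4⟩ := hp1
      obtain ⟨c1, c2⟩ := hy
      have hxi : (ψ x).im = 0 := by linarith
      have hci : (χ (star y * y)).im = 0 := by linarith
      rw [hxi, hci]
      refine ⟨?_, by simp⟩
      simp only [mul_zero, sub_zero, zero_mul, add_zero] at a1 a3 b1 b3 ⊢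
      set p := (ψ (star y * y)).re
      set c := (ψ x).re
      set X := (χ (star y * y)).re
      have hX : |X - c * p| ≤ 2 * ‖x‖ * p := by
        rw [abs_le]; constructor <;> nlinarith
      have h2 : |u * (X - c * p)| ≤ p := by
        rw [abs_mul]
        calc |u| * |X - c * p| ≤ |u| * (2 * ‖x‖ * p) := by gcongr
          _ = |u| * (2 * ‖x‖) * p := by ring
          _ ≤ 1 * p := by gcongr
          _ = p := one_mul p
      linarith [(abs_le.1 h2).1]
    · simp [hK.2.1, hχ1]
    · simp [hK.2.2.1, hχlam]
    · simp [hχunits, K_apply_units hψ.1]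
  -- On positive elements `|χ - ψ(x) ψ| ≤ 2‖x‖ ψ`, so `t · 2‖x‖ ≤ 1` preserves positivity; the
  -- summand `1` covers `x = 0`.
  set t : ℝ := 1 / (2 * ‖x‖ + 1)
  have ht : 0 < t := by positivity
  have htx : |t| * (2 * ‖x‖) ≤ 1 := by
    rw [abs_of_pos ht, one_div_mul_eq_div, div_le_one (by positivity)]
    linarith
  have hE := hψ.2 (hmem t htx) (hmem (-t) (by rwa [abs_neg])) (by
    refine ⟨1 / 2, 1 / 2, by norm_num, by norm_num, by norm_num, ?_⟩
    ext y
    simp only [add_apply, smul_apply, sub_apply, smul_eq_mul, Complex.real_smul]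
    push_cast
    ring)
  have hχψ (y : CuntzAlgebra d) : χ y = ψ x * ψ y := by
    have hy := DFunLike.congr_fun hE y
    simp only [add_apply, smul_apply, sub_apply, smul_eq_mul, add_eq_left, mul_eq_zero,
      Complex.ofReal_eq_zero, ht.ne', false_or] at hy
    exact sub_eq_zero.1 hy
  have hηeq : η = gnsVec (toPositive ψ h) (toPositive ψ h x • 1) := by
    refine eq_of_inner_gnsVec _ fun a => ?_
    rw [← hχ, hχψ, inner_gnsVec, toPositive_apply, toPositive_apply, star_smul, star_one,
      smul_mul_assoc, one_mul, map_smul, smul_eq_mul, hψx]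
  rw [IsClustering, ← hηeq]
  exact hη

theorem isClustering_of_mem_extremePoints {ω : SpinAlgebra d →ₚ[ℂ] ℂ} (h1 : ω 1 = 1)
    (hinv : ∀ x, ω (translation d x) = ω x) (hfactor : IsFactor ω)
    {ψ : StrongDual ℂ (CuntzAlgebra d)} (hψ : ψ ∈ (K ω).extremePoints ℝ)
    (h : ∀ x, 0 ≤ ψ (star x * x)) (x : CuntzAlgebra d) :
    IsClustering (toPositive ψ h) (lam d) x := by
  rw [← realPart_add_I_smul_imaginaryPart x]
  exact (isClustering_of_isSelfAdjoint h1 hinv hfactor hψ h (realPart x).2).add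
    ((isClustering_of_isSelfAdjoint h1 hinv hfactor hψ h (imaginaryPart x).2).smul _)

/-! ### The grading of the Cuntz algebra -/

/-- First letters cancel as long as they match, until two disagree or one word is exhausted. The
lengths are recorded for the grading. -/
theorem star_word_mul_word (J : List (Fin d)) : ∀ K : List (Fin d),
    star (word J) * word K = 0 ∨
    (∃ K', star (word J) * word K = word K' ∧ K.length = J.length + K'.length) ∨
    ∃ J', star (word J) * word K = star (word J') ∧ J.length = K.length + J'.length := by
  induction J with
  | nil => intro K; exact Or.inr (Or.inl ⟨K, by simp [word_nil], by simp⟩)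
  | cons j J ih =>
    intro K
    cases K with
    | nil => exact Or.inr (Or.inr ⟨j :: J, by simp [word_nil], by simp⟩)
    | cons k K =>
      have e : star (word (j :: J)) * word (k :: K) =
          star (word J) * (star (s j) * s k) * word K := by
        simp only [word_cons, star_mul, mul_assoc]
      rw [e, star_s_mul_s]
      split_ifs
      · rw [mul_one]
        rcases ih K with h | ⟨K', h, h'⟩ | ⟨J', h, h'⟩
        · exact Or.inl h
        · exact Or.inr (Or.inl ⟨K', h, by simp only [List.length_cons]; omega⟩)
        · exact Or.inr (Or.inr ⟨J', h, by simp only [List.length_cons]; omega⟩)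
      · exact Or.inl (by simp)

theorem monomial_mul_monomial (I J K L : List (Fin d)) :
    word I * star (word J) * (word K * star (word L)) = 0 ∨
    ∃ I' L' : List (Fin d), word I * star (word J) * (word K * star (word L)) =
      word I' * star (word L') ∧
      (I'.length - L'.length : ℤ) = (I.length - J.length) + (K.length - L.length) := by
  have e : word I * star (word J) * (word K * star (word L)) =
      word I * (star (word J) * word K) * star (word L) := by simp only [mul_assoc]
  rw [e]
  rcases star_word_mul_word J K with h | ⟨K', h, h'⟩ | ⟨J', h, h'⟩
  · exact Or.inl (by simp [h])
  · exact Or.inr ⟨I ++ K', L, by rw [h, word_append], by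
      rw [List.length_append]; push_cast; omega⟩
  · exact Or.inr ⟨I, L ++ J', by rw [h, word_append, star_mul, mul_assoc], by
      rw [List.length_append]; push_cast; omega⟩

/-- The span of the `s_I (s_J)*` with `|I| - |J| = n`. -/
def degree (d : ℕ) (n : ℤ) : Submodule ℂ (CuntzAlgebra d) :=
  Submodule.span ℂ {x | ∃ I J : List (Fin d), (I.length - J.length : ℤ) = n ∧
    word I * star (word J) = x}

theorem monomial_mem_degree (I J : List (Fin d)) :
    word I * star (word J) ∈ degree d (I.length - J.length) :=
  Submodule.subset_span ⟨I, J, rfl, rfl⟩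

theorem one_mem_degree : (1 : CuntzAlgebra d) ∈ degree d 0 := by
  simpa [word_nil] using monomial_mem_degree ([] : List (Fin d)) []

theorem mul_mem_degree {m n : ℤ} {x y : CuntzAlgebra d} (hx : x ∈ degree d m)
    (hy : y ∈ degree d n) : x * y ∈ degree d (m + n) := by
  induction hx, hy using Submodule.span_induction₂ with
  | mem_mem x y hx hy =>
    obtain ⟨I, J, rfl, rfl⟩ := hx
    obtain ⟨K, L, rfl, rfl⟩ := hy
    rcases monomial_mul_monomial I J K L with h | ⟨I', L', h, h'⟩
    · rw [h]; exact Submodule.zero_mem _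
    · rw [h, ← h']; exact monomial_mem_degree I' L'
  | zero_left => rw [zero_mul]; exact Submodule.zero_mem _
  | zero_right => rw [mul_zero]; exact Submodule.zero_mem _
  | add_left x y z _ _ _ h1 h2 => rw [add_mul]; exact add_mem h1 h2
  | add_right x y z _ _ _ h1 h2 => rw [mul_add]; exact add_mem h1 h2
  | smul_left c x y _ _ h => rw [smul_mul_assoc]; exact Submodule.smul_mem _ c h
  | smul_right c x y _ _ h => rw [mul_smul_comm]; exact Submodule.smul_mem _ c h

theorem star_mem_degree {n : ℤ} {x : CuntzAlgebra d} (hx : x ∈ degree d n) :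
    star x ∈ degree d (-n) := by
  induction hx using Submodule.span_induction with
  | mem x hx =>
    obtain ⟨I, J, rfl, rfl⟩ := hx
    rw [star_mul, star_star, neg_sub]
    exact monomial_mem_degree J I
  | zero => rw [star_zero]; exact Submodule.zero_mem _
  | add x y _ _ hx hy => rw [star_add]; exact add_mem hx hy
  | smul c x _ hx => rw [star_smul]; exact Submodule.smul_mem _ _ hx

theorem lam_mem_degree {n : ℤ} {x : CuntzAlgebra d} (hx : x ∈ degree d n) :
    lam d x ∈ degree d n := by
  rw [lam_apply, canonicalEndo]
  refine Submodule.sum_mem _ fun i _ => ?_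
  have h1 : (s i : CuntzAlgebra d) ∈ degree d 1 := by
    simpa [word_nil, word_singleton] using monomial_mem_degree [i] []
  have := mul_mem_degree (mul_mem_degree h1 hx) (star_mem_degree h1)
  rwa [show (1 : ℤ) + n + -1 = n by ring] at this

theorem avg_mem_degree {n : ℤ} {x : CuntzAlgebra d} (hx : x ∈ degree d n) (N : ℕ) :
    avg (lam d) N x ∈ degree d n := by
  rw [avg_apply]
  refine Submodule.smul_mem _ _ (Submodule.sum_mem _ fun k hk => ?_)
  clear hk
  induction k with
  | zero => exact hx
  | succ k ih => rw [Function.iterate_succ_apply']; exact lam_mem_degree ih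

/-- The linear span of the `s_I (s_J)*` is a *-subalgebra. -/
def polynomials (d : ℕ) : StarSubalgebra ℂ (CuntzAlgebra d) where
  carrier := (Submodule.span ℂ (Set.range fun p : List (Fin d) × List (Fin d) =>
    word p.1 * star (word p.2)) : Submodule ℂ (CuntzAlgebra d))
  algebraMap_mem' c := by
    rw [Algebra.algebraMap_eq_smul_one]
    exact Submodule.smul_mem _ _ (Submodule.subset_span ⟨([], []), by simp [word_nil]⟩)
  add_mem' := add_mem
  mul_mem' {x y} hx hy := by
    rw [SetLike.mem_coe] at hx hy ⊢
    induction hx, hy using Submodule.span_induction₂ with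
    | mem_mem x y hx hy =>
      obtain ⟨⟨I, J⟩, rfl⟩ := hx
      obtain ⟨⟨K, L⟩, rfl⟩ := hy
      rcases monomial_mul_monomial I J K L with h | ⟨I', L', h, h'⟩
      · simp only [h]; exact Submodule.zero_mem _
      · simp only [h]; exact Submodule.subset_span ⟨(I', L'), rfl⟩
    | zero_left => rw [zero_mul]; exact Submodule.zero_mem _
    | zero_right => rw [mul_zero]; exact Submodule.zero_mem _
    | add_left x y z _ _ _ h1 h2 => rw [add_mul]; exact add_mem h1 h2
    | add_right x y z _ _ _ h1 h2 => rw [mul_add]; exact add_mem h1 h2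
    | smul_left c x y _ _ h => rw [smul_mul_assoc]; exact Submodule.smul_mem _ c h
    | smul_right c x y _ _ h => rw [mul_smul_comm]; exact Submodule.smul_mem _ c h
  star_mem' {x} hx := by
    rw [SetLike.mem_coe] at hx ⊢
    induction hx using Submodule.span_induction with
    | mem x hx =>
      obtain ⟨⟨I, J⟩, rfl⟩ := hx
      exact Submodule.subset_span ⟨(J, I), by simp⟩
    | zero => rw [star_zero]; exact Submodule.zero_mem _
    | add x y _ _ hx hy => rw [star_add]; exact add_mem hx hy
    | smul c x _ hx => rw [star_smul]; exact Submodule.smul_mem _ _ hx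

theorem mem_polynomials {x : CuntzAlgebra d} : x ∈ polynomials d ↔
    x ∈ Submodule.span ℂ (Set.range fun p : List (Fin d) × List (Fin d) =>
      word p.1 * star (word p.2)) := Iff.rfl

theorem polynomials_dense : Dense (polynomials d : Set (CuntzAlgebra d)) :=
  cuntz_dense _ fun i => Submodule.subset_span ⟨([i], []), by simp [word_nil, word_singleton]⟩

theorem dual_ext {ψ φ : StrongDual ℂ (CuntzAlgebra d)}
    (h : ∀ I J : List (Fin d), ψ (word I * star (word J)) = φ (word I * star (word J))) :
    ψ = φ := by
  have h1 : Set.EqOn ψ.toLinearMap φ.toLinearMap (polynomials d) := by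
    intro x hx
    refine LinearMap.eqOn_span ?_ (mem_polynomials.1 hx)
    rintro _ ⟨p, rfl⟩
    exact h p.1 p.2
  ext x
  exact congrFun (Continuous.ext_on polynomials_dense ψ.continuous φ.continuous h1) x

/-- Degree zero is spanned by the `s_I s_J*` with `|I| = |J|`, whose values `ω` prescribes.
Comparisons of two clustering states are reduced to this case. -/
theorem eq_of_mem_degree_zero {ω : SpinAlgebra d →ₚ[ℂ] ℂ} {ψ φ : StrongDual ℂ (CuntzAlgebra d)}
    (hψ : ψ ∈ K ω) (hφ : φ ∈ K ω) {x : CuntzAlgebra d} (hx : x ∈ degree d 0) : ψ x = φ x := by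
  have h : Set.EqOn ψ.toLinearMap φ.toLinearMap {x | ∃ I J : List (Fin d),
      (I.length - J.length : ℤ) = 0 ∧ word I * star (word J) = x} := by
    rintro _ ⟨I, J, h, rfl⟩
    have h' : I.length = J.length := by omega
    have e : word I * star (word J) = cuntzUnits (I.zip J) := by
      rw [cuntzUnits, List.map_fst_zip h'.le, List.map_snd_zip h'.ge]
    change ψ _ = φ _
    rw [e, K_apply_units hψ, K_apply_units hφ]
  exact LinearMap.eqOn_span h hx

/-! ### The gauge action -/

theorem eval_gauge (z : Circle) (F : CuntzFamily d) (x : CuntzAlgebra d) :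
    F.eval (gauge d z x) = (F.rotate z).eval x := rfl

theorem CuntzFamily.rotate_rotate (z w : Circle) (F : CuntzFamily d) :
    (F.rotate z).rotate w = F.rotate (z * w) := by
  simp only [CuntzFamily.rotate, CuntzFamily.mk.injEq]
  ext1 i
  rw [smul_smul, Circle.coe_mul, mul_comm]

theorem gauge_gauge (z w : Circle) (x : CuntzAlgebra d) :
    gauge d z (gauge d w x) = gauge d (z * w) x :=
  cuntz_ext fun F => by simp only [eval_gauge, CuntzFamily.rotate_rotate]

theorem CuntzFamily.rotate_one (F : CuntzFamily d) : F.rotate 1 = F := by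
  cases F; simp [CuntzFamily.rotate]

theorem gauge_one (x : CuntzAlgebra d) : gauge d 1 x = x :=
  cuntz_ext fun F => by rw [eval_gauge, CuntzFamily.rotate_one]

theorem gauge_word (z : Circle) (I : List (Fin d)) :
    gauge d z (word I) = ((z : ℂ) ^ I.length) • word I := by
  induction I with
  | nil => simp [word_nil]
  | cons i I ih =>
    rw [word_cons, map_mul, gauge_s, ih, smul_mul_smul_comm, List.length_cons, pow_succ']

theorem gauge_monomial (z : Circle) (I J : List (Fin d)) :
    gauge d z (word I * star (word J)) =
      ((z ^ (I.length - J.length : ℤ) : Circle) : ℂ) • (word I * star (word J)) := by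
  rw [map_mul, map_star, gauge_word, gauge_word, star_smul, smul_mul_smul_comm]
  congr 1
  rw [zpow_sub, zpow_natCast, zpow_natCast, Circle.coe_mul, Circle.coe_inv_eq_conj,
    Circle.coe_pow, Circle.coe_pow]
  rfl

theorem gauge_of_mem_degree (z : Circle) {n : ℤ} {x : CuntzAlgebra d} (hx : x ∈ degree d n) :
    gauge d z x = ((z ^ n : Circle) : ℂ) • x := by
  induction hx using Submodule.span_induction with
  | mem x hx => obtain ⟨I, J, rfl, rfl⟩ := hx; exact gauge_monomial z I J
  | zero => rw [map_zero, smul_zero]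
  | add x y _ _ hx hy => rw [map_add, hx, hy, smul_add]
  | smul c x _ hx => rw [map_smul, hx, smul_comm]

/-- The functional `ψ ∘ β_z`. -/
def compGauge (ψ : StrongDual ℂ (CuntzAlgebra d)) (z : Circle) : StrongDual ℂ (CuntzAlgebra d) :=
  ψ.comp ⟨(gauge d z).toAlgHom.toLinearMap, AddMonoidHomClass.continuous_of_bound (gauge d z) 1
    fun x => by simpa only [one_mul] using NonUnitalStarAlgHom.norm_apply_le (gauge d z) x⟩

theorem compGauge_apply (ψ : StrongDual ℂ (CuntzAlgebra d)) (z : Circle) (x : CuntzAlgebra d) :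
    compGauge ψ z x = ψ (gauge d z x) := rfl

theorem eq_compGauge_of_degree {ψ φ : StrongDual ℂ (CuntzAlgebra d)} {z : Circle}
    (h : ∀ n, ∀ x ∈ degree d n, φ x = ((z ^ n : Circle) : ℂ) * ψ x) : φ = compGauge ψ z := by
  refine dual_ext fun I J => ?_
  have := monomial_mem_degree I J
  rw [compGauge_apply, gauge_of_mem_degree z this, map_smul, smul_eq_mul]
  exact h _ _ this

/-! ### Clustering states -/

theorem star_coe_circle (z : Circle) : star (z : ℂ) = (z⁻¹ : Circle) :=
  (Circle.coe_inv_eq_conj z).symm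

/-- A state in `K ω` with the mean clustering property. -/
def IsClusterState (ω : SpinAlgebra d →ₚ[ℂ] ℂ) (ψ : StrongDual ℂ (CuntzAlgebra d)) : Prop :=
  ψ ∈ K ω ∧ ∃ h : ∀ x, 0 ≤ ψ (star x * x), ∀ x, IsClustering (toPositive ψ h) (lam d) x

namespace IsClusterState

variable {ω : SpinAlgebra d →ₚ[ℂ] ℂ} {ψ φ : StrongDual ℂ (CuntzAlgebra d)}

theorem map_star (hψ : IsClusterState ω ψ) (x : CuntzAlgebra d) : ψ (star x) = star (ψ x) :=
  map_star_of_nonneg (mem_K_iff.1 hψ.1).1 x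

theorem map_one (hψ : IsClusterState ω ψ) : ψ 1 = 1 := (mem_K_iff.1 hψ.1).2.1

theorem tendsto_mul (hψ : IsClusterState ω ψ) (x y : CuntzAlgebra d) :
    Tendsto (fun N => ψ (avg (lam d) N x * avg (lam d) N y)) atTop (𝓝 (ψ x * ψ y)) := by
  obtain ⟨hK, h, hc⟩ := hψ
  exact IsClustering.map_mul (mem_K_iff.1 hK).2.1 hc x y

theorem tendsto_mul_mul (hψ : IsClusterState ω ψ) (x y z : CuntzAlgebra d) :
    Tendsto (fun N => ψ (avg (lam d) N x * avg (lam d) N y * avg (lam d) N z)) atTop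
      (𝓝 (ψ x * ψ y * ψ z)) := by
  obtain ⟨hK, h, hc⟩ := hψ
  exact IsClustering.map_mul_mul (mem_K_iff.1 hK).2.1 hc x y z

/-- Both sides are limits of values at `M_N(x) M_N(y*)`, which has degree zero. -/
theorem mul_eq_mul (hψ : IsClusterState ω ψ) (hφ : IsClusterState ω φ) {n : ℤ}
    {x y : CuntzAlgebra d} (hx : x ∈ degree d n) (hy : y ∈ degree d n) :
    ψ x * star (ψ y) = φ x * star (φ y) := by
  rw [← hψ.map_star, ← hφ.map_star]
  refine tendsto_nhds_unique (hψ.tendsto_mul x (star y))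
    ((hφ.tendsto_mul x (star y)).congr fun N => ?_)
  refine eq_of_mem_degree_zero hφ.1 hψ.1 ?_
  have := mul_mem_degree (avg_mem_degree hx N) (avg_mem_degree (star_mem_degree hy) N)
  rwa [add_neg_cancel] at this

/-- With three factors one can show that the phases relating two states are multiplicative in the
degree. -/
theorem mul_mul_eq_mul_mul (hψ : IsClusterState ω ψ) (hφ : IsClusterState ω φ) {m n : ℤ}
    {x y z : CuntzAlgebra d} (hx : x ∈ degree d m) (hy : y ∈ degree d n)
    (hz : z ∈ degree d (m + n)) :
    ψ x * ψ y * star (ψ z) = φ x * φ y * star (φ z) := by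
  rw [← hψ.map_star, ← hφ.map_star]
  refine tendsto_nhds_unique (hψ.tendsto_mul_mul x y (star z))
    ((hφ.tendsto_mul_mul x y (star z)).congr fun N => ?_)
  refine eq_of_mem_degree_zero hφ.1 hψ.1 ?_
  have := mul_mem_degree (mul_mem_degree (avg_mem_degree hx N) (avg_mem_degree hy N))
    (avg_mem_degree (star_mem_degree hz) N)
  rwa [add_neg_cancel] at this

/-- The degrees at which the state does not vanish. -/
def support (hψ : IsClusterState ω ψ) : AddSubgroup ℤ where
  carrier := {n | ∃ x ∈ degree d n, ψ x ≠ 0}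
  zero_mem' := ⟨1, one_mem_degree, by rw [hψ.map_one]; exact one_ne_zero⟩
  add_mem' := by
    rintro m n ⟨x, hx, hx'⟩ ⟨y, hy, hy'⟩
    by_contra hcon
    simp only [Set.mem_ofPred_eq, not_exists, not_and, not_not] at hcon
    -- The products of averages have degree `m + n`, and their values tend to `ψ(x) ψ(y) ≠ 0`, so
    -- they cannot all vanish.
    have h2 := hψ.tendsto_mul x y
    have h3 : ∀ N, ψ (avg (lam d) N x * avg (lam d) N y) = 0 := fun N =>
      hcon _ (mul_mem_degree (avg_mem_degree hx N) (avg_mem_degree hy N))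
    simp_rw [h3] at h2
    exact mul_ne_zero hx' hy' (tendsto_nhds_unique h2 tendsto_const_nhds)
  neg_mem' := by
    rintro n ⟨x, hx, hx'⟩
    exact ⟨star x, star_mem_degree hx, by rw [hψ.map_star]; exact star_ne_zero.2 hx'⟩

theorem mem_support (hψ : IsClusterState ω ψ) {n : ℤ} :
    n ∈ hψ.support ↔ ∃ x ∈ degree d n, ψ x ≠ 0 := Iff.rfl

theorem exists_period (hψ : IsClusterState ω ψ) :
    ∃ g : ℕ, ∀ n : ℤ, n ∈ hψ.support ↔ (g : ℤ) ∣ n := by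
  obtain ⟨a, ha⟩ := Int.subgroup_cyclic hψ.support
  refine ⟨a.natAbs, fun n => ?_⟩
  rw [ha, ← AddSubgroup.zmultiples_eq_closure, Int.mem_zmultiples_iff, Int.natAbs_dvd]

/-- In degree `n` the automorphism `β_z` multiplies by `zⁿ`, and `ψ` sees only the degrees divisible
by `g`. For `g = 0` both conditions always hold. -/
theorem invariant_iff (hψ : IsClusterState ω ψ) {g : ℕ}
    (hg : ∀ n : ℤ, n ∈ hψ.support ↔ (g : ℤ) ∣ n) (z : Circle) :
    (∀ x, ψ (gauge d z x) = ψ x) ↔ z ^ g = 1 := by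
  constructor
  · intro h
    obtain ⟨x, hx, hx'⟩ := hψ.mem_support.1 ((hg g).2 dvd_rfl)
    have := h x
    rw [gauge_of_mem_degree z hx, map_smul, smul_eq_mul, mul_eq_right₀ hx', zpow_natCast] at this
    exact Circle.ext this
  · intro h x
    have : ψ = compGauge ψ z := by
      refine eq_compGauge_of_degree fun n x hx => ?_
      by_cases hn : n ∈ hψ.support
      · obtain ⟨k, rfl⟩ := (hg n).1 hn
        rw [zpow_mul, zpow_natCast, h, one_zpow, Circle.coe_one, one_mul]
      · have : ψ x = 0 := by
          by_contra h0
          exact hn (hψ.mem_support.2 ⟨x, hx, h0⟩)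
        rw [this, mul_zero]
    exact (DFunLike.congr_fun this x).symm

theorem eq_mul_of_neg (hψ : IsClusterState ω ψ) (hφ : IsClusterState ω φ) {n : ℤ} {v : Circle}
    (h : ∀ y ∈ degree d n, φ y = v * ψ y) : ∀ y ∈ degree d (-n), φ y = (v⁻¹ : Circle) * ψ y := by
  intro y hy
  have h1 := h (star y) (by simpa using star_mem_degree hy)
  rw [hψ.map_star, hφ.map_star] at h1
  have h2 := congrArg star h1
  rwa [star_star, star_mul', star_star, star_coe_circle] at h2

/-- Elements `a`, `b` of degrees `m`, `n` with `ψ(a) ψ(b) ≠ 0` can be cancelled from the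
three-factor identity, which leaves the phase in degree `m + n`. -/
theorem eq_mul_of_add (hψ : IsClusterState ω ψ) (hφ : IsClusterState ω φ) {m n : ℤ}
    {v w : Circle} (hm : m ∈ hψ.support) (hn : n ∈ hψ.support)
    (hv : ∀ y ∈ degree d m, φ y = v * ψ y) (hw : ∀ y ∈ degree d n, φ y = w * ψ y) :
    ∀ y ∈ degree d (m + n), φ y = (v * w : Circle) * ψ y := by
  intro y hy
  obtain ⟨a, ha, ha'⟩ := hψ.mem_support.1 hm
  obtain ⟨b, hb, hb'⟩ := hψ.mem_support.1 hn
  have h := hψ.mul_mul_eq_mul_mul hφ ha hb hy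
  rw [hv a ha, hw b hb] at h
  have h1 : star (ψ y) = (v * w : Circle) * star (φ y) := by
    refine mul_left_cancel₀ (mul_ne_zero ha' hb') (h.trans ?_)
    rw [Circle.coe_mul]
    ring
  have h2 := congrArg star h1
  rw [star_star, star_mul', star_star, star_coe_circle, Circle.coe_inv] at h2
  rw [h2, mul_inv_cancel_left₀ (Circle.coe_ne_zero _)]

/-- Two states with the clustering property are related by a gauge automorphism. -/
theorem exists_eq_compGauge (hψ : IsClusterState ω ψ) (hφ : IsClusterState ω φ) :
    ∃ z : Circle, φ = compGauge ψ z := by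
  obtain ⟨g, hg⟩ := hψ.exists_period
  obtain ⟨x, hx, hx'⟩ := hψ.mem_support.1 ((hg g).2 dvd_rfl)
  -- This gives `|φ(x)| = |ψ(x)|`, so the quotient is a phase; `hbase` shows that it serves for all
  -- of degree `g`.
  have hxφ := hψ.mul_eq_mul hφ hx hx
  have hu : φ x / ψ x ∈ Submonoid.unitSphere ℂ := by
    rw [Submonoid.unitSphere, Submonoid.mem_mk, Subsemigroup.mem_mk, mem_sphere_zero_iff_norm,
      norm_div, div_eq_one_iff_eq (norm_ne_zero_iff.2 hx')]
    have := congrArg norm hxφ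
    simp only [norm_mul, norm_star] at this
    nlinarith [norm_nonneg (ψ x), norm_nonneg (φ x)]
  set u : Circle := ⟨φ x / ψ x, hu⟩ with hudef
  have hux : φ x = u * ψ x := by rw [hudef]; change φ x = φ x / ψ x * ψ x; field_simp
  have hbase : ∀ y ∈ degree d g, φ y = u * ψ y := by
    intro y hy
    have h := hψ.mul_eq_mul hφ hy hx
    rw [hux, star_mul', star_coe_circle, ← mul_assoc] at h
    rw [mul_right_cancel₀ (star_ne_zero.2 hx') h, Circle.coe_inv]
    field_simp [u.coe_ne_zero]
  have hpow : ∀ k : ℤ, ∀ y ∈ degree d (g * k), φ y = (u ^ k : Circle) * ψ y := by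
    have hsupp (k : ℤ) : (g : ℤ) * k ∈ hψ.support := (hg _).2 (dvd_mul_right _ _)
    intro k
    induction k with
    | zero =>
      intro y hy
      rw [mul_zero] at hy
      rw [zpow_zero, Circle.coe_one, one_mul, eq_of_mem_degree_zero hφ.1 hψ.1 hy]
    | succ k ih =>
      rw [zpow_add_one, mul_add_one]
      exact hψ.eq_mul_of_add hφ (hsupp k) ((hg _).2 dvd_rfl) ih hbase
    | pred k ih =>
      rw [zpow_sub_one, mul_sub_one, sub_eq_add_neg]
      exact hψ.eq_mul_of_add hφ (hsupp _) (neg_mem ((hg _).2 dvd_rfl)) ih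
        (hψ.eq_mul_of_neg hφ hbase)
  -- For `g > 0` any `g`-th root of `u` serves. For `g = 0` the element `x` has degree zero, where
  -- the states agree, so `u = 1`.
  obtain ⟨z, hz⟩ : ∃ z : Circle, z ^ g = u := by
    rcases Nat.eq_zero_or_pos g with rfl | hpos
    · refine ⟨1, Circle.ext ?_⟩
      have h0 := eq_of_mem_degree_zero hφ.1 hψ.1 (by simpa using hx)
      rw [hux, mul_eq_right₀ hx'] at h0
      rw [pow_zero, Circle.coe_one, h0]
    · obtain ⟨t, ht⟩ := Circle.exp_surjective u
      refine ⟨Circle.exp (t / g), ?_⟩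
      rw [← Circle.exp_natCast_mul, mul_div_cancel₀, ht]
      exact_mod_cast hpos.ne'
  refine ⟨z, eq_compGauge_of_degree fun n y hy => ?_⟩
  by_cases hn : n ∈ hψ.support
  · obtain ⟨k, rfl⟩ := (hg n).1 hn
    rw [zpow_mul, zpow_natCast, hz]
    exact hpow k y hy
  · have h0 : ψ y = 0 := by
      by_contra h0
      exact hn (hψ.mem_support.2 ⟨y, hy, h0⟩)
    have h := hψ.mul_eq_mul hφ hy hy
    rw [h0, zero_mul, zero_eq_mul, star_eq_zero, or_self] at h
    rw [h, h0, mul_zero]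

end IsClusterState

/-! ### A permutative representation of the Cuntz algebra -/

/-- The standard basis of `ℓ²(ℕ)`. -/
def basisVec (n : ℕ) : Hil := lp.single 2 n (1 : ℂ)

theorem inner_basisVec (n : ℕ) (f : Hil) : ⟪basisVec n, f⟫_ℂ = f n := by
  rw [basisVec, lp.inner_single_left]; simp

theorem inner_basisVec_basisVec (m n : ℕ) :
    ⟪basisVec m, basisVec n⟫_ℂ = if m = n then 1 else 0 := by
  rw [inner_basisVec, basisVec, lp.single_apply, Pi.single_apply]

theorem orthonormal_basisVec_comp {σ : ℕ → ℕ} (hσ : Function.Injective σ) :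
    Orthonormal ℂ fun n => basisVec (σ n) := by
  rw [orthonormal_iff_ite]
  intro m n
  rw [inner_basisVec_basisVec]
  simp only [hσ.eq_iff]

/-- The isometry of `ℓ²(ℕ)` induced by an injective map. -/
def shiftIsometry {σ : ℕ → ℕ} (hσ : Function.Injective σ) : Hil →ₗᵢ[ℂ] Hil :=
  (orthonormal_basisVec_comp hσ).orthogonalFamily.linearIsometry

theorem shiftIsometry_basisVec {σ : ℕ → ℕ} (hσ : Function.Injective σ) (n : ℕ) :
    shiftIsometry hσ (basisVec n) = basisVec (σ n) := by
  rw [basisVec, shiftIsometry, OrthogonalFamily.linearIsometry_apply_single]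
  simp

theorem star_shiftIsometry_apply {σ : ℕ → ℕ} (hσ : Function.Injective σ) (f : Hil) (n : ℕ) :
    (star (shiftIsometry hσ).toContinuousLinearMap f : Hil) n = f (σ n) := by
  rw [← inner_basisVec, ContinuousLinearMap.star_eq_adjoint,
    ContinuousLinearMap.adjoint_inner_right]
  change ⟪shiftIsometry hσ (basisVec n), f⟫_ℂ = _
  rw [shiftIsometry_basisVec, inner_basisVec]

theorem star_shiftIsometry_basisVec {σ : ℕ → ℕ} (hσ : Function.Injective σ) (n : ℕ) :
    star (shiftIsometry hσ).toContinuousLinearMap (basisVec (σ n)) = basisVec n := by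
  ext m
  rw [star_shiftIsometry_apply, basisVec, basisVec, lp.single_apply, lp.single_apply,
    Pi.single_apply, Pi.single_apply]
  simp only [hσ.eq_iff]

theorem star_shiftIsometry_basisVec_of_notMem {σ : ℕ → ℕ} (hσ : Function.Injective σ) {n : ℕ}
    (hn : ∀ m, σ m ≠ n) :
    star (shiftIsometry hσ).toContinuousLinearMap (basisVec n) = 0 := by
  ext m
  rw [star_shiftIsometry_apply, basisVec, lp.single_apply, Pi.single_apply, if_neg (hn m)]
  rfl

theorem shiftIsometry_apply {σ : ℕ → ℕ} (hσ : Function.Injective σ) (f : Hil) (n : ℕ) :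
    (shiftIsometry hσ f : Hil) (σ n) = f n := by
  rw [← inner_basisVec (σ n), ← shiftIsometry_basisVec hσ, LinearIsometry.inner_map_map,
    inner_basisVec]

theorem shiftIsometry_apply_of_notMem {σ : ℕ → ℕ} (hσ : Function.Injective σ) (f : Hil) {n : ℕ}
    (hn : ∀ m, σ m ≠ n) : (shiftIsometry hσ f : Hil) n = 0 := by
  have h := ContinuousLinearMap.adjoint_inner_left (shiftIsometry hσ).toContinuousLinearMap f
    (basisVec n)
  rw [← ContinuousLinearMap.star_eq_adjoint, star_shiftIsometry_basisVec_of_notMem hσ hn,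
    inner_zero_left, inner_basisVec] at h
  exact h.symm

theorem digit_injective (hd : 2 ≤ d) (i : Fin d) :
    Function.Injective fun n : ℕ => d * n + i := by
  intro m n h
  have h' : d * m = d * n := by simpa using h
  exact Nat.eq_of_mul_eq_mul_left (by omega) h'

theorem digit_inj (hd : 2 ≤ d) {i j : Fin d} {m n : ℕ} (h : d * m + i = d * n + j) :
    i = j ∧ m = n := by
  have h1 := congrArg (· % d) h
  simp only [Nat.mul_add_mod, Nat.mod_eq_of_lt i.2, Nat.mod_eq_of_lt j.2] at h1
  have h2 : i = j := Fin.ext h1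
  subst h2
  exact ⟨rfl, digit_injective hd i h⟩

/-- The Cuntz family with `S i e_n = e_{d n + i}`. -/
def digitFamily (hd : 2 ≤ d) : CuntzFamily d where
  S i := (shiftIsometry (digit_injective hd i)).toContinuousLinearMap
  orthogonal i j := by
    ext f n
    change (star (shiftIsometry (digit_injective hd i)).toContinuousLinearMap
      (shiftIsometry (digit_injective hd j) f) : Hil) n = _
    rw [star_shiftIsometry_apply]
    split_ifs with h
    · subst h
      exact shiftIsometry_apply (digit_injective hd i) f n
    · exact shiftIsometry_apply_of_notMem _ f fun m hm => h (digit_inj hd hm).1.symm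
  complete := by
    ext f n
    have hdpos : 0 < d := by omega
    obtain ⟨i, m, rfl⟩ : ∃ (i : Fin d) (m : ℕ), d * m + i = n :=
      ⟨⟨n % d, Nat.mod_lt _ hdpos⟩, n / d, Nat.div_add_mod n d⟩
    rw [sum_apply, lp.coeFn_sum, Finset.sum_apply, Finset.sum_eq_single i]
    · exact (shiftIsometry_apply (digit_injective hd i) _ m).trans
        (star_shiftIsometry_apply (digit_injective hd i) f m)
    · intro j _ hj
      exact shiftIsometry_apply_of_notMem (digit_injective hd j) _ fun l hl => hj (digit_inj hd hl).1
    · simp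

theorem digitFamily_S (hd : 2 ≤ d) (i : Fin d) : (digitFamily hd).S i =
    (shiftIsometry (digit_injective hd i)).toContinuousLinearMap := rfl

/-- The number with the base `d` digits `1` and `I`, read backwards. -/
def digitsNum : List (Fin d) → ℕ
  | [] => 1
  | i :: I => d * digitsNum I + i

theorem one_le_digitsNum (hd : 2 ≤ d) : ∀ I : List (Fin d), 1 ≤ digitsNum I
  | [] => le_rfl
  | i :: I => by
    have := one_le_digitsNum hd I
    rw [digitsNum]
    nlinarith

/-- The leading digit `1` marks the end of the word: nonempty words have numbers at least `d > 1`,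
and division by `d` recovers the letters. -/
theorem digitsNum_injective (hd : 2 ≤ d) : Function.Injective (digitsNum (d := d)) := by
  intro I
  induction I with
  | nil =>
    intro J h
    cases J with
    | nil => rfl
    | cons j J =>
      have := one_le_digitsNum hd J
      simp only [digitsNum] at h
      nlinarith
  | cons i I ih =>
    intro J h
    cases J with
    | nil =>
      have := one_le_digitsNum hd I
      simp only [digitsNum] at h
      nlinarith
    | cons j J =>
      obtain ⟨h1, h2⟩ := digit_inj hd h
      rw [h1, ih h2]

/-- The vectors `S_I e_1`. -/
def wordVec (I : List (Fin d)) : Hil := basisVec (digitsNum I)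

/-- By this orthonormality, matrix elements of monomials between long enough words only compare
prefixes and remainders. -/
theorem inner_wordVec (hd : 2 ≤ d) (I J : List (Fin d)) :
    ⟪wordVec I, wordVec J⟫_ℂ = if I = J then 1 else 0 := by
  rw [wordVec, wordVec, inner_basisVec_basisVec]
  simp only [(digitsNum_injective hd).eq_iff]

theorem star_S_wordVec_cons (hd : 2 ≤ d) (i j : Fin d) (I : List (Fin d)) :
    star ((digitFamily hd).S i) (wordVec (j :: I)) = if i = j then wordVec I else 0 := by
  rw [digitFamily_S, wordVec, digitsNum]
  split_ifs with h
  · subst h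
    exact star_shiftIsometry_basisVec (digit_injective hd i) (digitsNum I)
  · exact star_shiftIsometry_basisVec_of_notMem (digit_injective hd i)
      fun m hm => h (digit_inj hd hm).1

theorem star_word_wordVec_append (hd : 2 ≤ d) (I A : List (Fin d)) :
    (digitFamily hd).eval (star (word I)) (wordVec (I ++ A)) = wordVec A := by
  induction I with
  | nil => simp [word_nil]
  | cons i I ih =>
    rw [word_cons, star_mul, map_mul, map_star _ (s i), CuntzFamily.eval_s,
      mul_apply_eq_comp, List.cons_append, star_S_wordVec_cons, if_pos rfl, ih]

theorem star_word_wordVec_eq_zero_or (hd : 2 ≤ d) (I : List (Fin d)) :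
    ∀ A : List (Fin d), I.length ≤ A.length →
    (digitFamily hd).eval (star (word I)) (wordVec A) = 0 ∨ ∃ B, A = I ++ B := by
  induction I with
  | nil => exact fun A _ => Or.inr ⟨A, rfl⟩
  | cons i I ih =>
    intro A h
    cases A with
    | nil => simp at h
    | cons a A =>
      rw [word_cons, star_mul, map_mul, map_star _ (s i), CuntzFamily.eval_s,
        mul_apply_eq_comp, star_S_wordVec_cons]
      split_ifs with hia
      · subst hia
        rcases ih A (by simpa using h) with h' | ⟨B, rfl⟩
        · exact Or.inl h'
        · exact Or.inr ⟨B, rfl⟩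
      · exact Or.inl (map_zero _)

theorem inner_monomial_wordVec (hd : 2 ≤ d) (I J A B : List (Fin d)) :
    ⟪wordVec A, (digitFamily hd).eval (word I * star (word J)) (wordVec B)⟫_ℂ =
      ⟪(digitFamily hd).eval (star (word I)) (wordVec A),
        (digitFamily hd).eval (star (word J)) (wordVec B)⟫_ℂ := by
  rw [map_mul, mul_apply_eq_comp, map_star _ (word I),
    ContinuousLinearMap.star_eq_adjoint, ContinuousLinearMap.adjoint_inner_left]

/-! ### Words of given length -/

/-- The words of length `m`. -/
def words (d : ℕ) : ℕ → Finset (List (Fin d))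
  | 0 => {[]}
  | m + 1 => (Finset.univ ×ˢ words d m).image fun p : Fin d × List (Fin d) => p.1 :: p.2

theorem mem_words {m : ℕ} : ∀ {I : List (Fin d)}, I ∈ words d m ↔ I.length = m := by
  induction m with
  | zero => intro I; simp [words, List.length_eq_zero_iff]
  | succ m ih =>
    intro I
    cases I with
    | nil => simp [words]
    | cons i I => simp [words, ih]

/-- The words with length in `[m, n)`. -/
def wordsIco (d m n : ℕ) : Finset (List (Fin d)) := (Finset.Ico m n).biUnion (words d)

theorem mem_wordsIco {m n : ℕ} {I : List (Fin d)} :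
    I ∈ wordsIco d m n ↔ m ≤ I.length ∧ I.length < n := by
  simp [wordsIco, mem_words]

theorem sum_wordsIco (m n : ℕ) (g : List (Fin d) → ℂ) :
    ∑ I ∈ wordsIco d m n, g I = ∑ k ∈ Finset.Ico m n, ∑ I ∈ words d k, g I := by
  rw [wordsIco, Finset.sum_biUnion]
  intro k _ l _ hkl
  rw [Function.onFun, Finset.disjoint_left]
  intro I hI hI'
  rw [mem_words] at hI hI'
  exact hkl (hI.symm.trans hI')

theorem sum_words_succ (m : ℕ) (g : List (Fin d) → ℂ) :
    ∑ I ∈ words d (m + 1), g I = ∑ i, ∑ I ∈ words d m, g (i :: I) := by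
  rw [words, Finset.sum_image, Finset.sum_product]
  rintro ⟨i, I⟩ _ ⟨j, J⟩ _ h
  simpa using h

/-! ### States from positive definite kernels -/

/-- The kernels `(I, J) ↦ ψ (s_I (s_J)*)` of states `ψ` of the Cuntz algebra. -/
structure IsStateKernel (k : List (Fin d) → List (Fin d) → ℂ) : Prop where
  star_eq : ∀ I J, star (k I J) = k J I
  nonneg : ∀ (W : Finset (List (Fin d))) (c : List (Fin d) → ℂ),
    0 ≤ ∑ I ∈ W, ∑ J ∈ W, star (c I) * c J * k I J
  sum_append : ∀ I J, ∑ p, k (I ++ [p]) (J ++ [p]) = k I J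
  one : k [] [] = 1

namespace IsStateKernel

variable {k : List (Fin d) → List (Fin d) → ℂ}

theorem sum_words_append (hk : IsStateKernel k) (m : ℕ) : ∀ I J,
    ∑ A ∈ words d m, k (I ++ A) (J ++ A) = k I J := by
  induction m with
  | zero => intro I J; simp [words]
  | succ m ih =>
    intro I J
    rw [sum_words_succ, ← hk.sum_append I J]
    refine Finset.sum_congr rfl fun p _ => ?_
    rw [← ih]
    simp

/-- A finite positive semidefinite matrix is a Gram matrix. This exhibits the approximating
functionals as positive combinations of vector functionals. -/
theorem exists_factorization (hk : IsStateKernel k) (W : Finset (List (Fin d))) :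
    ∃ (m : ℕ) (v : Fin m → List (Fin d) → ℂ), ∀ I ∈ W, ∀ J ∈ W,
      k I J = ∑ r, star (v r I) * v r J := by
  have hM : (Matrix.of fun I J : W => k I J).PosSemidef := by
    rw [Matrix.posSemidef_iff_dotProduct_mulVec]
    refine ⟨Matrix.IsHermitian.ext fun I J => hk.star_eq J I, fun c => ?_⟩
    have h := hk.nonneg W fun I => if hI : I ∈ W then c ⟨I, hI⟩ else 0
    rw [← Finset.sum_coe_sort] at h
    convert h using 1
    rw [dotProduct]
    refine Finset.sum_congr rfl fun I _ => ?_
    rw [Matrix.mulVec, dotProduct, Finset.mul_sum, ← Finset.sum_coe_sort W]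
    refine Finset.sum_congr rfl fun J _ => ?_
    simp
    ring
  obtain ⟨m, v, hv⟩ := Matrix.posSemidef_iff_eq_sum_vecMulVec.1 hM
  refine ⟨m, fun r I => if hI : I ∈ W then star (v r ⟨I, hI⟩) else 0, fun I hI J hJ => ?_⟩
  have h := congrFun (congrFun hv ⟨I, hI⟩) ⟨J, hJ⟩
  rw [Matrix.sum_apply] at h
  simpa [hI, hJ, Matrix.vecMulVec_apply] using h

end IsStateKernel

/-- The functional `x ↦ ⟨u, π(x) v⟩` in the representation given by a Cuntz family. -/
def coefficient (F : CuntzFamily d) (u v : Hil) : CuntzAlgebra d →ₗ[ℂ] ℂ where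
  toFun x := ⟪u, F.eval x v⟫_ℂ
  map_add' x y := by rw [map_add, add_apply, inner_add_right]
  map_smul' c x := by rw [map_smul, smul_apply, inner_smul_right]; rfl

theorem coefficient_apply (F : CuntzFamily d) (u v : Hil) (x : CuntzAlgebra d) :
    coefficient F u v x = ⟪u, F.eval x v⟫_ℂ := rfl

/-- The approximations of the functional with kernel `k`. -/
def kernelApprox (hd : 2 ≤ d) (k : List (Fin d) → List (Fin d) → ℂ) (N : ℕ) :
    CuntzAlgebra d →ₗ[ℂ] ℂ :=
  (N : ℂ)⁻¹ • ∑ A ∈ wordsIco d N (2 * N), ∑ B ∈ wordsIco d N (2 * N),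
    k A B • coefficient (digitFamily hd) (wordVec A) (wordVec B)

theorem kernelApprox_apply (hd : 2 ≤ d) (k : List (Fin d) → List (Fin d) → ℂ) (N : ℕ)
    (x : CuntzAlgebra d) : kernelApprox hd k N x =
      (N : ℂ)⁻¹ * ∑ A ∈ wordsIco d N (2 * N), ∑ B ∈ wordsIco d N (2 * N),
        k A B * ⟪wordVec A, (digitFamily hd).eval x (wordVec B)⟫_ℂ := by
  simp [kernelApprox, coefficient_apply]

namespace IsStateKernel

variable {k : List (Fin d) → List (Fin d) → ℂ}

/-- Only the pairs `(IC, JC)` contribute, and for each length of `C` they add up to `k I J` by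
consistency. Admissible lengths run from `N - min` to below `2N - max`, so their proportion among
`N` tends to one. Windows starting at `N` make all words long enough to contain the prefixes. -/
theorem kernelApprox_monomial (hd : 2 ≤ d) (hk : IsStateKernel k) (I J : List (Fin d)) {N : ℕ}
    (hI : I.length ≤ N) (hJ : J.length ≤ N) :
    kernelApprox hd k N (word I * star (word J)) =
      (N : ℂ)⁻¹ * ((2 * N - max I.length J.length - (N - min I.length J.length) : ℕ) * k I J) := by
  rw [kernelApprox_apply, ← Finset.sum_product']
  congr 1
  set V := wordsIco d (N - min I.length J.length) (2 * N - max I.length J.length)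
  have hinj : Function.Injective fun C : List (Fin d) => (I ++ C, J ++ C) := fun C D h => by
    simpa using h
  have hsub : V.image (fun C => (I ++ C, J ++ C)) ⊆
      wordsIco d N (2 * N) ×ˢ wordsIco d N (2 * N) := by
    intro p hp
    obtain ⟨C, hC, rfl⟩ := Finset.mem_image.1 hp
    rw [mem_wordsIco] at hC
    simp only [Finset.mem_product, mem_wordsIco, List.length_append]
    omega
  rw [← Finset.sum_subset hsub, Finset.sum_image hinj.injOn]
  · simp only [inner_monomial_wordVec, star_word_wordVec_append, inner_wordVec hd, if_true, mul_one]
    rw [sum_wordsIco]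
    simp only [hk.sum_words_append]
    rw [Finset.sum_const, Nat.card_Ico, nsmul_eq_mul]
  · rintro ⟨A, B⟩ hp hp'
    simp only [Finset.mem_product, mem_wordsIco] at hp
    obtain ⟨⟨hA1, hA2⟩, hB1, hB2⟩ := hp
    rw [inner_monomial_wordVec]
    rcases star_word_wordVec_eq_zero_or hd I A (by omega) with h | ⟨C, rfl⟩
    · rw [h, inner_zero_left, mul_zero]
    rcases star_word_wordVec_eq_zero_or hd J B (by omega) with h | ⟨D, rfl⟩
    · rw [h, inner_zero_right, mul_zero]
    rw [star_word_wordVec_append, star_word_wordVec_append, inner_wordVec hd]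
    rw [if_neg, mul_zero]
    rintro rfl
    refine hp' (Finset.mem_image.2 ⟨C, ?_, rfl⟩)
    rw [mem_wordsIco]
    simp only [List.length_append] at hA1 hA2 hB1 hB2
    omega

theorem tendsto_kernelApprox_monomial (hd : 2 ≤ d) (hk : IsStateKernel k) (I J : List (Fin d)) :
    Tendsto (fun N => kernelApprox hd k N (word I * star (word J))) atTop (𝓝 (k I J)) := by
  set a := max I.length J.length
  set b := min I.length J.length
  have h : Tendsto (fun N : ℕ => (1 + (N : ℂ)⁻¹ * ((b : ℂ) - a)) * k I J) atTop
      (𝓝 ((1 + 0 * ((b : ℂ) - a)) * k I J)) :=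
    ((tendsto_inv_atTop_nhds_zero_nat.mul_const _).const_add 1).mul_const _
  rw [zero_mul, add_zero, one_mul] at h
  refine h.congr' ?_
  filter_upwards [eventually_ge_atTop (a + 1)] with N hN
  rw [kernelApprox_monomial hd hk I J (by omega) (by omega)]
  have hN' : (N : ℂ) ≠ 0 := by norm_cast; omega
  have e : ((2 * N - a - (N - b) : ℕ) : ℂ) = N + (b - a) := by
    rw [eq_comm, ← sub_eq_zero]
    have : 2 * N - a - (N - b) + a = N + b := by omega
    have h' : ((2 * N - a - (N - b) : ℕ) : ℂ) + a = N + b := by exact_mod_cast this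
    linear_combination -h'
  rw [e]
  field_simp

theorem kernelApprox_one (hd : 2 ≤ d) (hk : IsStateKernel k) {N : ℕ} (hN : N ≠ 0) :
    kernelApprox hd k N 1 = 1 := by
  have h := kernelApprox_monomial hd hk [] [] (N := N) (by simp) (by simp)
  have hN' : (N : ℂ) ≠ 0 := by exact_mod_cast hN
  have e : 2 * N - N = N := by omega
  simpa [word_nil, hk.one, hN', e] using h

theorem exists_kernelApprox_eq (hd : 2 ≤ d) (hk : IsStateKernel k) (N : ℕ) :
    ∃ (m : ℕ) (ξ : Fin m → Hil), ∀ x, kernelApprox hd k N x =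
      (N : ℂ)⁻¹ * ∑ r, ⟪ξ r, (digitFamily hd).eval x (ξ r)⟫_ℂ := by
  obtain ⟨m, v, hv⟩ := hk.exists_factorization (wordsIco d N (2 * N))
  refine ⟨m, fun r => ∑ A ∈ wordsIco d N (2 * N), v r A • wordVec A, fun x => ?_⟩
  rw [kernelApprox_apply]
  congr 1
  have h (r : Fin m) : ⟪∑ A ∈ wordsIco d N (2 * N), v r A • wordVec A,
      (digitFamily hd).eval x (∑ A ∈ wordsIco d N (2 * N), v r A • wordVec A)⟫_ℂ =
      ∑ A ∈ wordsIco d N (2 * N), ∑ B ∈ wordsIco d N (2 * N),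
        star (v r A) * v r B * ⟪wordVec A, (digitFamily hd).eval x (wordVec B)⟫_ℂ := by
    simp only [map_sum, map_smul, sum_inner, inner_sum, inner_smul_left, inner_smul_right,
      starRingEnd_apply, Finset.mul_sum]
    rw [Finset.sum_comm]
    exact Finset.sum_congr rfl fun A _ => Finset.sum_congr rfl fun B _ => by ring
  simp_rw [h]
  rw [Finset.sum_comm (s := (Finset.univ : Finset (Fin m)))]
  refine Finset.sum_congr rfl fun A hA => ?_
  rw [Finset.sum_comm (s := (Finset.univ : Finset (Fin m)))]
  refine Finset.sum_congr rfl fun B hB => ?_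
  rw [hv A hA B hB, Finset.sum_mul]

theorem kernelApprox_nonneg (hd : 2 ≤ d) (hk : IsStateKernel k) (N : ℕ) (x : CuntzAlgebra d) :
    0 ≤ kernelApprox hd k N (star x * x) := by
  obtain ⟨m, ξ, h⟩ := hk.exists_kernelApprox_eq hd N
  rw [h]
  refine mul_nonneg (by rw [← Complex.ofReal_natCast, ← Complex.ofReal_inv]
                        exact Complex.zero_le_real.2 (by positivity))
    (Finset.sum_nonneg fun r _ => ?_)
  rw [map_mul, mul_apply_eq_comp, map_star, ContinuousLinearMap.star_eq_adjoint,
    ContinuousLinearMap.adjoint_inner_right, inner_self_eq_norm_sq_to_K]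
  rw [← RCLike.ofReal_pow, RCLike.ofReal_nonneg]
  positivity

/-- The value `1` at the identity fixes the total weight of the vectors `ξ r`; Cauchy–Schwarz does
the rest. -/
theorem norm_kernelApprox_le (hd : 2 ≤ d) (hk : IsStateKernel k) (N : ℕ) (x : CuntzAlgebra d) :
    ‖kernelApprox hd k N x‖ ≤ 1 * ‖x‖ := by
  rcases Nat.eq_zero_or_pos N with rfl | hN
  · simp [kernelApprox_apply]
  obtain ⟨m, ξ, h⟩ := hk.exists_kernelApprox_eq hd N
  have h1 : (N : ℝ)⁻¹ * ∑ r, ‖ξ r‖ ^ 2 = 1 := by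
    have h2 := h 1
    rw [hk.kernelApprox_one hd hN.ne'] at h2
    simp only [map_one, one_apply_eq_self, inner_self_eq_norm_sq_to_K] at h2
    apply Complex.ofReal_injective
    push_cast
    exact h2.symm
  rw [h, norm_mul, norm_inv, Complex.norm_natCast, ← h1, mul_assoc, Finset.sum_mul]
  gcongr
  refine norm_sum_le_of_le _ fun r _ => ?_
  calc _ ≤ ‖ξ r‖ * ‖(digitFamily hd).eval x (ξ r)‖ := norm_inner_le_norm _ _
    _ ≤ ‖ξ r‖ * (‖x‖ * ‖ξ r‖) := by
      gcongr
      refine (ContinuousLinearMap.le_opNorm _ _).trans ?_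
      gcongr
      exact NonUnitalStarAlgHom.norm_apply_le (digitFamily hd).eval x
    _ = _ := by ring

/-- A positive definite kernel with the properties of the kernel of a state is the kernel of a
state. -/
theorem exists_state (hd : 2 ≤ d) (hk : IsStateKernel k) :
    ∃ ψ : StrongDual ℂ (CuntzAlgebra d), (∀ I J, ψ (word I * star (word J)) = k I J) ∧
      ∀ x, 0 ≤ ψ (star x * x) := by
  let f (N : ℕ) : StrongDual ℂ (CuntzAlgebra d) :=
    (kernelApprox hd k N).mkContinuous 1 (hk.norm_kernelApprox_le hd N)
  have hf (N : ℕ) (x : CuntzAlgebra d) : f N x = kernelApprox hd k N x := rfl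
  obtain ⟨ψ, hψ⟩ := exists_strong_limit_of_dense f (C := 1)
    (fun N => LinearMap.mkContinuous_norm_le _ zero_le_one _) polynomials_dense (by
      intro x hx
      rw [SetLike.mem_coe, mem_polynomials] at hx
      induction hx using Submodule.span_induction with
      | mem x hx =>
        obtain ⟨p, rfl⟩ := hx
        exact ⟨_, hk.tendsto_kernelApprox_monomial hd p.1 p.2⟩
      | zero => exact ⟨0, by simp⟩
      | add x y _ _ hx hy =>
        obtain ⟨a, ha⟩ := hx
        obtain ⟨b, hb⟩ := hy
        exact ⟨a + b, by simpa only [map_add] using ha.add hb⟩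
      | smul c x _ hx =>
        obtain ⟨a, ha⟩ := hx
        exact ⟨c • a, by simpa only [map_smul] using ha.const_smul c⟩)
  refine ⟨ψ, fun I J => ?_, fun x => ?_⟩
  · exact tendsto_nhds_unique (hψ _) (hk.tendsto_kernelApprox_monomial hd I J)
  · exact ge_of_tendsto' (hψ _) fun N => hk.kernelApprox_nonneg hd N x

end IsStateKernel

theorem mem_K_of_words {ω : SpinAlgebra d →ₚ[ℂ] ℂ} {ψ : StrongDual ℂ (CuntzAlgebra d)}
    (h0 : ∀ x, 0 ≤ ψ (star x * x)) (h1 : ψ 1 = 1)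
    (hlam : ∀ I J : List (Fin d), ∑ p, ψ (word (p :: I) * star (word (p :: J))) =
      ψ (word I * star (word J)))
    (hω : ∀ L : List (Fin d × Fin d), ψ (cuntzUnits L) = ω (matrixUnits L)) : ψ ∈ K ω := by
  refine mem_K_iff.2 ⟨h0, h1, fun x => ?_, hω⟩
  let ψ' : StrongDual ℂ (CuntzAlgebra d) :=
    ψ.comp ⟨(lam d).toAlgHom.toLinearMap, AddMonoidHomClass.continuous_of_bound (lam d) 1
      fun x => by simpa only [one_mul] using NonUnitalStarAlgHom.norm_apply_le (lam d) x⟩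
  have h : ψ' = ψ := by
    refine dual_ext fun I J => ?_
    rw [← hlam I J]
    change ψ (lam d _) = _
    rw [lam_apply, canonicalEndo, map_sum]
    simp only [word_cons, star_mul, mul_assoc]
  exact DFunLike.congr_fun h x

theorem sum_word_cons_of_mem_K {ω : SpinAlgebra d →ₚ[ℂ] ℂ} {ψ : StrongDual ℂ (CuntzAlgebra d)}
    (hψ : ψ ∈ K ω) (I J : List (Fin d)) : ∑ p, ψ (word (p :: I) * star (word (p :: J))) =
      ψ (word I * star (word J)) := by
  rw [← (mem_K_iff.1 hψ).2.2.1, lam_apply, canonicalEndo, map_sum]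
  simp only [word_cons, star_mul, mul_assoc]

/-! ### The dual state -/

/-- Positivity is that of `Y Y*`, where `Y` is the combination of the reversed words with conjugate
coefficients. Reversal moves an appended letter to the front, so consistency is `λ`-invariance. -/
theorem isStateKernel_reverse {ω : SpinAlgebra d →ₚ[ℂ] ℂ} {ψ : StrongDual ℂ (CuntzAlgebra d)}
    (hψ : ψ ∈ K ω) : IsStateKernel fun I J : List (Fin d) =>
      ψ (word I.reverse * star (word J.reverse)) where
  star_eq I J := by rw [← map_star_of_nonneg (mem_K_iff.1 hψ).1, star_mul, star_star]
  nonneg W c := by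
    have h := (mem_K_iff.1 hψ).1 (star (∑ I ∈ W, star (c I) • word I.reverse))
    rw [star_star, star_sum, Finset.sum_mul_sum] at h
    simpa only [map_sum, star_smul, star_star, smul_mul_smul_comm, map_smul, smul_eq_mul] using h
  sum_append I J := by
    simp only [List.reverse_append, List.reverse_singleton, List.singleton_append]
    exact sum_word_cons_of_mem_K hψ _ _
  one := by simpa [word_nil] using (mem_K_iff.1 hψ).2.1

theorem exists_isDual (hd : 2 ≤ d) {ω : SpinAlgebra d →ₚ[ℂ] ℂ}
    {ψ : StrongDual ℂ (CuntzAlgebra d)} (hψ : ψ ∈ K ω) :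
    ∃ φ, IsDual ψ φ ∧ ∀ x, 0 ≤ φ (star x * x) := by
  obtain ⟨φ, h1, h2⟩ := (isStateKernel_reverse hψ).exists_state hd
  exact ⟨φ, h1, h2⟩

theorem IsDual.unique {ψ φ φ' : StrongDual ℂ (CuntzAlgebra d)} (h : IsDual ψ φ)
    (h' : IsDual ψ φ') : φ = φ' :=
  dual_ext fun I J => (h I J).trans (h' I J).symm

theorem IsDual.symm {ψ φ : StrongDual ℂ (CuntzAlgebra d)} (h : IsDual ψ φ) : IsDual φ ψ :=
  fun I J => by rw [h, List.reverse_reverse, List.reverse_reverse]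

theorem IsDual.compGauge {ψ φ : StrongDual ℂ (CuntzAlgebra d)} (h : IsDual ψ φ) (z : Circle) :
    IsDual (compGauge ψ z) (compGauge φ z) := fun I J => by
  rw [compGauge_apply, compGauge_apply, gauge_monomial, gauge_monomial, map_smul, map_smul, h,
    List.length_reverse, List.length_reverse]

theorem eval_relabel (e : ℤ ≃ ℤ) (F : ChainRep d) (x : SpinAlgebra d) :
    F.eval (relabel d e x) = (F.relabel e).eval x := rfl

theorem translation_reflection_translation (x : SpinAlgebra d) :
    translation d (reflection d (translation d x)) = reflection d x := by
  refine spin_ext fun F => ?_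
  simp only [translation, reflection, eval_relabel]
  congr 2
  simp only [ChainRep.relabel, ChainRep.mk.injEq]
  funext j
  congr 1
  simp only [Equiv.subLeft_apply, Equiv.coe_addRight]
  ring

theorem reflection_site (j : ℤ) (Q : Matrix (Fin d) (Fin d) ℂ) :
    reflection d (site j Q) = site (1 - j) Q := relabel_site _ _ _ _

theorem matrixUnits_append_singleton (L : List (Fin d × Fin d)) (p : Fin d × Fin d) :
    matrixUnits (L ++ [p]) =
      matrixUnits L * site (L.length + 1) (Matrix.single p.1 p.2 1) := by
  rw [matrixUnits, List.mapIdx_concat, List.prod_append, List.prod_singleton]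
  rfl

theorem site_commute_matrixUnits (L : List (Fin d × Fin d)) {j : ℤ} (hj : L.length < j)
    (Q : Matrix (Fin d) (Fin d) ℂ) : Commute (site j Q) (matrixUnits L) := by
  refine Commute.list_prod_right _ _ fun x hx => ?_
  obtain ⟨a, ha, rfl⟩ := List.mem_mapIdx.1 hx
  exact site_commute (by omega) _ _

/-- The reflection carries the sites `1, …, k` to `0, …, 1 - k`, and `k` translations bring them
back in reverse order. -/
theorem iterate_translation_reflection (L : List (Fin d × Fin d)) :
    (translation d)^[L.length] (reflection d (matrixUnits L)) = matrixUnits L.reverse := by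
  induction L with
  | nil => simp [matrixUnits_nil]
  | cons p L ih =>
    rw [matrixUnits_cons, map_mul, iterate_mul, reflection_site, translation_iterate_site,
      List.length_cons, Function.iterate_succ_apply, translation_reflection_translation, ih,
      List.reverse_cons, matrixUnits_append_singleton, List.length_reverse]
    have := site_commute_matrixUnits L.reverse (j := L.length + 1) (by simp)
      (Matrix.single p.1 p.2 1)
    rw [← this.eq]
    congr 2
    push_cast
    ring

theorem map_matrixUnits_reverse {ω : SpinAlgebra d →ₚ[ℂ] ℂ}
    (hinv : ∀ x, ω (translation d x) = ω x) (hsym : ∀ x, ω (reflection d x) = ω x)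
    (L : List (Fin d × Fin d)) : ω (matrixUnits L.reverse) = ω (matrixUnits L) := by
  rw [← iterate_translation_reflection, map_iterate hinv, hsym]

/-- The roles are exchanged: `λ`-invariance of the dual is the Cuntz relation under `ψ`, and the
values on `UHF_d` are right because `ω` is unchanged under reversal of the sites. -/
theorem IsDual.mem_K {ω : SpinAlgebra d →ₚ[ℂ] ℂ}
    (hinv : ∀ x, ω (translation d x) = ω x) (hsym : ∀ x, ω (reflection d x) = ω x)
    {ψ φ : StrongDual ℂ (CuntzAlgebra d)} (hψ : ψ ∈ K ω) (h : IsDual ψ φ)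
    (h0 : ∀ x, 0 ≤ φ (star x * x)) : φ ∈ K ω := by
  refine mem_K_of_words h0 ?_ (fun I J => ?_) fun L => ?_
  · have := h [] []
    simp only [word_nil, List.reverse_nil, star_one, mul_one] at this
    rw [this, (mem_K_iff.1 hψ).2.1]
  · have e : word I.reverse * star (word J.reverse) =
        ∑ p : Fin d, word (I.reverse ++ [p]) * star (word (J.reverse ++ [p])) := by
      have : ∀ p : Fin d, word (I.reverse ++ [p]) * star (word (J.reverse ++ [p])) =
          word I.reverse * (s p * star (s p)) * star (word J.reverse) := fun p => by
        simp only [word_append, word_singleton, star_mul, mul_assoc]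
      simp only [this, ← Finset.sum_mul, ← Finset.mul_sum, sum_s_mul_star_s, mul_one]
    rw [h I J, e, map_sum]
    refine Finset.sum_congr rfl fun p _ => ?_
    rw [h, List.reverse_cons, List.reverse_cons]
  · rw [cuntzUnits, h, ← map_matrixUnits_reverse hinv hsym, ← K_apply_units hψ, cuntzUnits,
      List.map_reverse, List.map_reverse]

/-! ### The gauge invariant extension -/

/-- This is the kernel of the state that vanishes in all nonzero degrees; it shows that `K ω` is
nonempty. -/
theorem isStateKernel_zip (hd : 2 ≤ d) {ω : SpinAlgebra d →ₚ[ℂ] ℂ} (h1 : ω 1 = 1) :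
    IsStateKernel fun I J : List (Fin d) =>
      if I.length = J.length then ω (matrixUnits (I.zip J)) else 0 where
  star_eq I J := by
    by_cases h : I.length = J.length
    · rw [if_pos h, if_pos h.symm, ← map_star_gns, star_matrixUnits, List.zip_swap]
    · rw [if_neg h, if_neg (Ne.symm h), star_zero]
  nonneg W c := by
    -- With a fixed word `b` of length `m` one has `e_IJ = e_bI* e_bJ`, so the quadratic form is a
    -- sum over lengths of values `ω(X_m* X_m)`.
    let b (m : ℕ) : List (Fin d) := List.replicate m ⟨0, by omega⟩
    let g (m : ℕ) (I : List (Fin d)) : SpinAlgebra d :=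
      if I.length = m then matrixUnits ((b m).zip I) else 0
    have hg (m : ℕ) (I J : List (Fin d)) : star (g m I) * g m J =
        if I.length = m ∧ J.length = m then matrixUnits (I.zip J) else 0 := by
      by_cases hI : I.length = m
      · by_cases hJ : J.length = m
        · simp only [g, if_pos hI, if_pos hJ, hI, hJ, and_self, if_true]
          rw [star_matrixUnits, List.zip_swap, matrixUnits_zip_mul_zip _ _ _ (by simp [b, hI])
            (by simp [b, hJ])]
        · simp [g, hJ]
      · simp [g, hI]
    have e : ∑ I ∈ W, ∑ J ∈ W, star (c I) * c J *
        (if I.length = J.length then ω (matrixUnits (I.zip J)) else 0) =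
        ∑ m ∈ W.image List.length, ω (star (∑ I ∈ W, c I • g m I) * ∑ I ∈ W, c I • g m I) := by
      simp only [star_sum, Finset.sum_mul_sum, map_sum, star_smul, smul_mul_smul_comm, map_smul,
        smul_eq_mul, hg]
      rw [Finset.sum_comm (s := W.image List.length)]
      refine Finset.sum_congr rfl fun I hI => ?_
      rw [Finset.sum_comm (s := W.image List.length)]
      refine Finset.sum_congr rfl fun J _ => ?_
      rw [Finset.sum_eq_single I.length]
      · by_cases h : I.length = J.length
        · rw [if_pos h, if_pos ⟨rfl, h.symm⟩]
        · rw [if_neg h, if_neg fun h' => h h'.2.symm, map_zero]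
      · intro m _ hm
        rw [if_neg fun h' => hm h'.1.symm, map_zero, mul_zero]
      · exact fun h => absurd (Finset.mem_image_of_mem _ hI) h
    rw [e]
    exact Finset.sum_nonneg fun m _ => ω.map_nonneg (star_mul_self_nonneg _)
  sum_append I J := by
    by_cases h : I.length = J.length
    · simp only [List.length_append, h, if_true, List.zip_append h, List.length_singleton]
      rw [← map_sum]
      exact congrArg ω (matrixUnits_append_sum _)
    · simp [h]
  one := by simp [matrixUnits_nil, h1]

theorem K_nonempty (hd : 2 ≤ d) {ω : SpinAlgebra d →ₚ[ℂ] ℂ} (h1 : ω 1 = 1)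
    (hinv : ∀ x, ω (translation d x) = ω x) : (K ω).Nonempty := by
  obtain ⟨ψ, hψ, h0⟩ := (isStateKernel_zip hd h1).exists_state hd
  refine ⟨ψ, mem_K_of_words h0 ?_ (fun I J => ?_) fun L => ?_⟩
  · have := hψ [] []
    simpa [word_nil, matrixUnits_nil, h1] using this
  · simp only [hψ, List.length_cons, add_left_inj, List.zip_cons_cons]
    split_ifs with h
    · rw [← map_sum, ← hinv (matrixUnits (I.zip J))]
      simp only [matrixUnits_cons, ← Finset.sum_mul, sum_site_single, one_mul]
    · simp
  · rw [cuntzUnits, hψ, if_pos (by simp)]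
    congr 2
    exact (List.zip_of_prod rfl rfl).symm

/-! ### Extremal points -/

/-- Cauchy–Schwarz in the GNS space; the bound is what weak-* compactness requires. -/
theorem norm_le_of_mem_K {ω : SpinAlgebra d →ₚ[ℂ] ℂ} {ψ : StrongDual ℂ (CuntzAlgebra d)}
    (hψ : ψ ∈ K ω) : ‖ψ‖ ≤ 1 := by
  have hK := mem_K_iff.1 hψ
  refine ContinuousLinearMap.opNorm_le_bound _ zero_le_one fun x => ?_
  set f := toPositive ψ hK.1
  have h1 : ‖gnsVec f 1‖ = 1 := by
    have h := norm_gnsVec_sq f 1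
    rw [star_one, one_mul, toPositive_apply, hK.2.1, Complex.ofReal_eq_one] at h
    exact (pow_eq_one_iff_of_nonneg (norm_nonneg _) two_ne_zero).1 h
  have h2 : ψ x = ⟪gnsVec f 1, gnsVec f x⟫_ℂ := by
    rw [inner_gnsVec, star_one, one_mul, toPositive_apply]
  have h3 := norm_gnsVec_mul_le f x 1
  rw [mul_one, h1] at h3
  rw [h2]
  refine (norm_inner_le_norm _ _).trans ?_
  rw [h1]
  linarith

/-- All conditions that define `K ω` are closed under pointwise convergence. The image in the space
of functions is used so that the existence of extreme points can be applied there. -/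
theorem isCompact_image_K (ω : SpinAlgebra d →ₚ[ℂ] ℂ) :
    IsCompact ((fun ψ : StrongDual ℂ (CuntzAlgebra d) => (ψ : CuntzAlgebra d → ℂ)) '' K ω) := by
  have hb : Bornology.IsBounded (K ω) := by
    refine (Metric.isBounded_closedBall (x := 0) (r := 1)).subset fun ψ hψ => ?_
    rw [mem_closedBall_zero_iff]
    exact norm_le_of_mem_K hψ
  refine ContinuousLinearMap.isCompact_image_coe_of_bounded_of_closed_image hb
    (ContinuousLinearMap.isClosed_image_coe_of_bounded_of_weak_closed hb fun ψ hψ => ?_)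
  have hc {C : Set (CuntzAlgebra d → ℂ)} (hC : IsClosed C)
      (h : ∀ φ ∈ K ω, (φ : CuntzAlgebra d → ℂ) ∈ C) : (ψ : CuntzAlgebra d → ℂ) ∈ C := by
    refine closure_minimal ?_ hC hψ
    rintro _ ⟨φ, hφ, rfl⟩
    exact h φ hφ
  refine mem_K_iff.2 ⟨fun x => ?_, ?_, fun x => ?_, fun L => ?_⟩
  · exact hc (C := {u | 0 ≤ u (star x * x)})
      (isClosed_le continuous_const (continuous_apply _)) fun φ hφ => (mem_K_iff.1 hφ).1 x
  · exact hc (C := {u | u 1 = 1}) (isClosed_eq (continuous_apply _) continuous_const)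
      fun φ hφ => (mem_K_iff.1 hφ).2.1
  · exact hc (C := {u | u (lam d x) = u x})
      (isClosed_eq (continuous_apply _) (continuous_apply _)) fun φ hφ => (mem_K_iff.1 hφ).2.2.1 x
  · exact hc (C := {u | u (cuntzUnits L) = ω (matrixUnits L)})
      (isClosed_eq (continuous_apply _) continuous_const) fun φ hφ => K_apply_units hφ L

theorem K_extremePoints_nonempty (hd : 2 ≤ d) {ω : SpinAlgebra d →ₚ[ℂ] ℂ} (h1 : ω 1 = 1)
    (hinv : ∀ x, ω (translation d x) = ω x) : ((K ω).extremePoints ℝ).Nonempty := by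
  obtain ⟨_, ⟨ψ, hψ, rfl⟩, hext⟩ :=
    (isCompact_image_K ω).extremePoints_nonempty ((K_nonempty hd h1 hinv).image _)
  refine ⟨ψ, hψ, fun φ₁ h₁ φ₂ h₂ h => ?_⟩
  have := hext ⟨φ₁, h₁, rfl⟩ ⟨φ₂, h₂, rfl⟩ (by
    obtain ⟨a, b, ha, hb, hab, rfl⟩ := h
    exact ⟨a, b, ha, hb, hab, rfl⟩)
  exact DFunLike.coe_injective this

theorem isClusterState_of_mem_extremePoints {ω : SpinAlgebra d →ₚ[ℂ] ℂ} (h1 : ω 1 = 1)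
    (hinv : ∀ x, ω (translation d x) = ω x) (hfactor : IsFactor ω)
    {ψ : StrongDual ℂ (CuntzAlgebra d)} (hψ : ψ ∈ (K ω).extremePoints ℝ) :
    IsClusterState ω ψ :=
  ⟨hψ.1, (mem_K_iff.1 hψ.1).1, isClustering_of_mem_extremePoints h1 hinv hfactor hψ _⟩

theorem convex_comb_mem_K {ω : SpinAlgebra d →ₚ[ℂ] ℂ} {ψ φ : StrongDual ℂ (CuntzAlgebra d)}
    (hψ : ψ ∈ K ω) (hφ : φ ∈ K ω) {a b : ℝ} (ha : 0 ≤ a) (hb : 0 ≤ b) (hab : a + b = 1) :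
    a • ψ + b • φ ∈ K ω := by
  have h1 := mem_K_iff.1 hψ
  have h2 := mem_K_iff.1 hφ
  have hab' : (a : ℂ) + b = 1 := by exact_mod_cast hab
  refine mem_K_iff.2 ⟨fun x => ?_, ?_, fun x => ?_, fun L => ?_⟩ <;>
    simp only [add_apply, smul_apply, Complex.real_smul]
  · exact add_nonneg (mul_nonneg (Complex.zero_le_real.2 ha) (h1.1 x))
      (mul_nonneg (Complex.zero_le_real.2 hb) (h2.1 x))
  · rw [h1.2.1, h2.2.1, mul_one, mul_one, hab']
  · rw [h1.2.2.1, h2.2.2.1]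
  · rw [h1.2.2.2, h2.2.2.2, ← add_mul, hab', one_mul]

theorem IsDual.convex_comb {ψ φ ψ' φ' : StrongDual ℂ (CuntzAlgebra d)} (hψ : IsDual ψ ψ')
    (hφ : IsDual φ φ') (a b : ℝ) : IsDual (a • ψ + b • φ) (a • ψ' + b • φ') := fun I J => by
  simp only [add_apply, smul_apply, hψ I J, hφ I J]

/-- The dual of an extremal state is extremal. -/
theorem IsDual.mem_extremePoints (hd : 2 ≤ d) {ω : SpinAlgebra d →ₚ[ℂ] ℂ}
    (hinv : ∀ x, ω (translation d x) = ω x) (hsym : ∀ x, ω (reflection d x) = ω x)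
    {ψ φ : StrongDual ℂ (CuntzAlgebra d)} (hψ : ψ ∈ (K ω).extremePoints ℝ) (h : IsDual ψ φ)
    (hφ : φ ∈ K ω) : φ ∈ (K ω).extremePoints ℝ := by
  refine ⟨hφ, fun φ₁ h₁ φ₂ h₂ hseg => ?_⟩
  obtain ⟨ψ₁, hd₁, hp₁⟩ := exists_isDual hd h₁
  obtain ⟨ψ₂, hd₂, hp₂⟩ := exists_isDual hd h₂
  have hK₁ := hd₁.mem_K hinv hsym h₁ hp₁
  have hK₂ := hd₂.mem_K hinv hsym h₂ hp₂
  -- Dualising turns an open segment around `φ` into one around `ψ`; extremality gives `ψ₁ = ψ`, and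
  -- dualising back gives `φ₁ = φ`.
  have := hψ.2 hK₁ hK₂ (by
    obtain ⟨a, b, ha, hb, hab, rfl⟩ := hseg
    exact ⟨a, b, ha, hb, hab, (hd₁.convex_comb hd₂ a b).unique h.symm⟩)
  rw [this] at hd₁
  exact hd₁.symm.unique h

theorem eq_exp_pi_of_sq_eq_one {w : Circle} (h : w ^ 2 = 1) (hw : w ≠ 1) :
    w = Circle.exp Real.pi := by
  have h1 : ((w : ℂ)) ^ 2 = 1 := by exact_mod_cast congrArg (Subtype.val : Circle → ℂ) h
  rcases mul_self_eq_one_iff.1 ((sq (w : ℂ)).symm.trans h1) with h2 | h2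
  · exact absurd (Circle.ext h2) hw
  · refine Circle.ext ?_
    rw [h2, Circle.coe_exp, Complex.exp_pi_mul_I]

end SpinChain

end

/-! ### Duality, the stabiliser `H` and the choice of `ζ`. -/

theorem proposition3p1 (d : ℕ) (hd : 2 ≤ d)
    (ω : SpinChain.SpinAlgebra d →ₚ[ℂ] ℂ) (hω_one : ω 1 = 1)
    (hω_inv : ∀ x, ω (SpinChain.translation d x) = ω x)
    (hω_sym : ∀ x, ω (SpinChain.reflection d x) = ω x)
    (hω_factor : SpinChain.IsFactor ω) :
    ∃ T : StrongDual ℂ (SpinChain.CuntzAlgebra d) → StrongDual ℂ (SpinChain.CuntzAlgebra d),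
      (∀ ψ ∈ SpinChain.K ω, ∀ φ, SpinChain.IsDual ψ φ ↔ φ = T ψ) ∧
      Set.BijOn T (SpinChain.K ω) (SpinChain.K ω) ∧
      (∀ ψ ∈ SpinChain.K ω, ∀ φ ∈ SpinChain.K ω, ∀ a b : ℝ, 0 ≤ a → 0 ≤ b → a + b = 1 →
        a • ψ + b • φ ∈ SpinChain.K ω ∧ T (a • ψ + b • φ) = a • T ψ + b • T φ) ∧
      ∃ H : Subgroup Circle,
        (∀ φ ∈ (SpinChain.K ω).extremePoints ℝ, ∀ z : Circle,
          z ∈ H ↔ ∀ x, φ (SpinChain.gauge d z x) = φ x) ∧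
        ∃ ψ ∈ (SpinChain.K ω).extremePoints ℝ, ∃ ζ : Circle,
          (∀ x, T ψ x = ψ (SpinChain.gauge d ζ x)) ∧ ζ ^ 2 ∈ H ∧
          ((∃ n : ℕ, 1 ≤ n ∧ (∀ z : Circle, z ∈ H ↔ z ^ n = 1) ∧
              (ζ = 1 ∨ ζ = Circle.exp (Real.pi / n))) ∨
            (H = ⊤ ∧ ζ = 1)) := by
  classical
  have hex (ψ : StrongDual ℂ (SpinChain.CuntzAlgebra d)) (hψ : ψ ∈ SpinChain.K ω) :
      ∃ φ, SpinChain.IsDual ψ φ ∧ φ ∈ SpinChain.K ω := by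
    obtain ⟨φ, h, h0⟩ := SpinChain.exists_isDual hd hψ
    exact ⟨φ, h, h.mem_K hω_inv hω_sym hψ h0⟩
  choose! T hT hTK using hex
  have hTT : ∀ ψ ∈ SpinChain.K ω, T (T ψ) = ψ := fun ψ hψ =>
    (hT _ (hTK ψ hψ)).unique (hT ψ hψ).symm
  refine ⟨T, fun ψ hψ φ => ⟨fun h => h.unique (hT ψ hψ), fun h => h ▸ hT ψ hψ⟩,
    ⟨hTK, fun ψ hψ φ hφ h => by rw [← hTT ψ hψ, h, hTT φ hφ],
      fun ψ hψ => ⟨T ψ, hTK ψ hψ, hTT ψ hψ⟩⟩, fun ψ hψ φ hφ a b ha hb hab => ?_, ?_⟩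
  · have h := SpinChain.convex_comb_mem_K hψ hφ ha hb hab
    exact ⟨h, (hT _ h).unique ((hT ψ hψ).convex_comb (hT φ hφ) a b)⟩
  obtain ⟨ψ, hψ⟩ := SpinChain.K_extremePoints_nonempty hd hω_one hω_inv
  have hcl {φ} (hφ : φ ∈ (SpinChain.K ω).extremePoints ℝ) :=
    SpinChain.isClusterState_of_mem_extremePoints hω_one hω_inv hω_factor hφ
  obtain ⟨g, hg⟩ := (hcl hψ).exists_period
  have hinv := (hcl hψ).invariant_iff hg
  -- The kernel is the whole circle if `g = 0`. Another extremal point is `ψ β_w`, with the same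
  -- stabiliser because gauge automorphisms commute.
  refine ⟨(powMonoidHom g : Circle →* Circle).ker, fun φ hφ z => ?_, ψ, hψ, ?_⟩
  · rw [MonoidHom.mem_ker, powMonoidHom_apply, ← hinv]
    obtain ⟨w, rfl⟩ := (hcl hψ).exists_eq_compGauge (hcl hφ)
    simp only [SpinChain.compGauge_apply, SpinChain.gauge_gauge]
    constructor
    · intro h x
      rw [mul_comm, ← SpinChain.gauge_gauge, h]
    · intro h x
      have := h (SpinChain.gauge d w⁻¹ x)
      rwa [SpinChain.gauge_gauge, SpinChain.gauge_gauge, mul_inv_cancel, SpinChain.gauge_one,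
        mul_comm w, mul_inv_cancel_right] at this
  obtain ⟨z, hz⟩ := (hcl hψ).exists_eq_compGauge
    (hcl ((hT ψ hψ.1).mem_extremePoints hd hω_inv hω_sym hψ (hTK ψ hψ.1)))
  -- Dualising commutes with `β_z`, so the dual of `T ψ = ψ β_z` is `ψ β_{z²}`; it is also `ψ`.
  have hz2 : (z ^ 2) ^ g = 1 := by
    rw [← hinv]
    have h1 : SpinChain.IsDual (T ψ) (SpinChain.compGauge (T ψ) z) := by
      have := (hT ψ hψ.1).compGauge z
      rwa [← hz] at this
    have h2 := (hT ψ hψ.1).symm.unique h1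
    intro x
    have h3 := DFunLike.congr_fun h2 x
    rw [SpinChain.compGauge_apply, hz, SpinChain.compGauge_apply, SpinChain.gauge_gauge,
      ← sq] at h3
    exact h3.symm
  simp only [MonoidHom.mem_ker, powMonoidHom_apply]
  by_cases hzg : z ^ g = 1
  · refine ⟨1, fun x => ?_, by simp, ?_⟩
    · rw [hz, SpinChain.compGauge_apply, (hinv z).2 hzg, SpinChain.gauge_one]
    · rcases Nat.eq_zero_or_pos g with rfl | hpos
      · refine Or.inr ⟨?_, rfl⟩
        ext w
        simp [MonoidHom.mem_ker]
      · exact Or.inl ⟨g, hpos, fun _ => Iff.rfl, Or.inl rfl⟩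
  · have hpos : 1 ≤ g := by
      rcases Nat.eq_zero_or_pos g with rfl | hpos
      · exact absurd (pow_zero z) hzg
      · exact hpos
    have hg0 : (g : ℝ) ≠ 0 := by exact_mod_cast (Nat.pos_iff_ne_zero.1 hpos)
    have hζ : Circle.exp (Real.pi / g) ^ g = Circle.exp Real.pi := by
      rw [← Circle.exp_natCast_mul, mul_div_cancel₀ _ hg0]
    have hzpi : z ^ g = Circle.exp Real.pi :=
      SpinChain.eq_exp_pi_of_sq_eq_one (by rw [← pow_mul, mul_comm, pow_mul, hz2]) hzg
    refine ⟨Circle.exp (Real.pi / g), fun x => ?_, ?_, Or.inl ⟨g, hpos, fun _ => Iff.rfl,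
      Or.inr rfl⟩⟩
    -- Both `z` and `e^{πi/g}` have `g`-th power `-1`, so they differ by an element of `H`, which
    -- does not affect `ψ β_z`.
    · have h1 : (z / Circle.exp (Real.pi / g)) ^ g = 1 := by
        rw [div_pow, hζ, hzpi, div_self']
      have h2 := (hinv _).2 h1 (SpinChain.gauge d (Circle.exp (Real.pi / g)) x)
      rw [SpinChain.gauge_gauge, div_mul_cancel] at h2
      rw [hz, SpinChain.compGauge_apply, h2]
    · rw [← pow_mul, mul_comm, pow_mul, hζ, ← hzpi, ← pow_mul, mul_comm, pow_mul, hz2]
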